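/- For $n\ge 1$ let $Q_n$ be the $n$-cube, let $v$ be a vertex of $Q_n$, and let $v^{o}$ be the vertex opposite to $v$, that is, the vertex at distance $n$ from $v$. The link of $v$ in the boundary complex of $Q_n$ is the complex of all faces $F$ of $Q_n$ such that $v\notin F$ and $F$ lies in some proper face of $Q_n$ containing $v$. The graph of a complex consists of its vertices and its edges. A graph $G$ is $k$-linked if it has at least $2k$ vertices and, for any $2k$ distinct vertices $s_1,t_1,\dots,s_k,t_k$ of $G$, there are $k$ pairwise vertex-disjoint paths in $G$, the $i$-th of which joins $s_i$ to $t_i$. \begin{proposition} Let $d\ge 0$ be an integer with $d\ne 1$ and $d\neq 3$. For every vertex $v$ of the $(d+1)$-cube $Q_{d+1}$, the link of $v$ in the boundary complex of $Q_{d+1}$ equals the subcomplex $Q_{d+1}-\{v,v^{o}\}$ of all faces of $Q_{d+1}$ that contain neither $v$ nor $v^{o}$, and its graph is $\lfloor (d+1)/2\rfloor$-linked. \end{proposition} -/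

import Mathlib

/-- A graph is `k`-linked if it has at least `2k` vertices and, for any `2k` distinct vertices
organised in `k` pairs `{s i, t i}`, there are pairwise vertex-disjoint paths, the `i`-th of which
joins `s i` to `t i`. -/
def SimpleGraph.IsKLinked {V : Type*} (G : SimpleGraph V) (k : ℕ) : Prop :=
  ((2 * k : ℕ) : ℕ∞) ≤ ENat.card V ∧
    ∀ s t : Fin k → V, Function.Injective (Sum.elim s t) →
      ∃ p : (i : Fin k) → G.Path (s i) (t i),
        ∀ i j : Fin k, i ≠ j →
          ∀ x : V, x ∈ (p i).1.support → x ∉ (p j).1.support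

namespace FaceComplex

/-! A polytopal complex is recorded combinatorially, by the vertex sets of its faces. -/

variable {V : Type*}

/-- The star of the vertex `v`: all faces containing `v`, and the faces of these. -/
def star (C : Set (Set V)) (v : V) : Set (Set V) :=
  {F | F ∈ C ∧ ∃ G ∈ C, v ∈ G ∧ F ⊆ G}

/-- The link of the vertex `v`: all faces of the star of `v` that are disjoint from `v`. -/
def link (C : Set (Set V)) (v : V) : Set (Set V) :=
  {F | F ∈ star C v ∧ v ∉ F}

/-- The complex `C - X` obtained by removing the vertices in `X`: all faces of `C` that contain
only vertices outside `X`. -/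
def deleteVerts (C : Set (Set V)) (X : Set V) : Set (Set V) :=
  {F | F ∈ C ∧ F ⊆ Xᶜ}

/-- The graph of a complex: its vertices are the vertices of `C`, and its edges are the
one-dimensional faces of `C`, that is, the faces with exactly two vertices. -/
def graph (C : Set (Set V)) : SimpleGraph {x : V // {x} ∈ C} where
  Adj x y := x ≠ y ∧ ({x.1, y.1} : Set V) ∈ C
  symm := ⟨fun x y h => ⟨h.1.symm, by rw [Set.pair_comm]; exact h.2⟩⟩
  loopless := ⟨fun _ h => h.1 rfl⟩

end FaceComplex

namespace BoolCube

/-- The complex of all faces of the `n`-cube with vertex set `{0,1}ⁿ`: the empty face, and the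
sets obtained by prescribing the values of some of the coordinates (none of them for the cube
itself). -/
def faces (n : ℕ) : Set (Set (Fin n → Bool)) :=
  {F | F = ∅ ∨ ∃ (I : Set (Fin n)) (a : Fin n → Bool), F = {x | ∀ i ∈ I, x i = a i}}

/-- The boundary complex of the `n`-cube: all its proper faces. -/
def boundary (n : ℕ) : Set (Set (Fin n → Bool)) :=
  {F | F ∈ faces n ∧ F ≠ Set.univ}

/-- The vertex opposite to `v` in the `n`-cube, which differs from `v` in all `n` coordinates. -/
def opposite {n : ℕ} (v : Fin n → Bool) : Fin n → Bool := fun i => !(v i)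

end BoolCube

/-!
Disjoint paths for `k` pairs off a set `Z` of forbidden vertices exist in the `n`-cube, `n ≥ 4`,
whenever `2 k + #Z ≤ n + 1`. By induction on `k`: choose a direction `e` and a pair `i₀`, keep the
facet of its first terminal for a path joining this pair, and let all other terminals of that facet
step along `e` to the opposite one, where the remaining pairs are linked by induction. A terminal
whose step is obstructed moves first to a free neighbour in its own facet; Hall's theorem makes
these moves simultaneously. The pair `i₀` can then be joined, because in the `m`-cube any two
vertices that keep a free neighbour stay connected after the removal of at most `2 m - 3` others.

The construction fails only if the count is tight around a single vertex, a terminal with no free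
neighbour or an end of the path that is cut off. The other terminals are then so close to this
vertex that another direction or another pair succeeds.

For `Z = {v, opposite v}` the count holds if `n` is odd and is exceeded by one if `n` is even. Each
facet contains only one of these two vertices, so a single step of the construction restores it.
-/

section Linkage

variable {V W ι : Type*} {G : SimpleGraph V} {H : SimpleGraph W} {U U' Z Z' : Set V} {a b c : V}

/-- Reachability by a walk that visits only vertices of `U`, its two ends included. -/
def ReachableWithin (G : SimpleGraph V) (U : Set V) (a b : V) : Prop :=
  ∃ p : G.Walk a b, ∀ x ∈ p.support, x ∈ U

theorem ReachableWithin.refl (ha : a ∈ U) : ReachableWithin G U a a :=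
  ⟨.nil, by simpa using ha⟩

theorem ReachableWithin.symm (h : ReachableWithin G U a b) : ReachableWithin G U b a := by
  obtain ⟨p, hp⟩ := h
  exact ⟨p.reverse, by simpa using hp⟩

theorem ReachableWithin.trans (h : ReachableWithin G U a b) (h' : ReachableWithin G U b c) :
    ReachableWithin G U a c := by
  obtain ⟨p, hp⟩ := h
  obtain ⟨q, hq⟩ := h'
  exact ⟨p.append q, fun x hx =>
    ((SimpleGraph.Walk.mem_support_append_iff _ _).1 hx).elim (hp x) (hq x)⟩

theorem ReachableWithin.mono (h : ReachableWithin G U a b) (hU : U ⊆ U') :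
    ReachableWithin G U' a b := by
  obtain ⟨p, hp⟩ := h
  exact ⟨p, fun x hx => hU (hp x hx)⟩

theorem ReachableWithin.of_adj (h : G.Adj a b) (ha : a ∈ U) (hb : b ∈ U) :
    ReachableWithin G U a b :=
  ⟨h.toWalk, by simp [ha, hb]⟩

theorem ReachableWithin.map (h : ReachableWithin G U a b) (f : G →g H) :
    ReachableWithin H (f '' U) (f a) (f b) := by
  obtain ⟨p, hp⟩ := h
  refine ⟨p.map f, fun x hx => ?_⟩
  rw [SimpleGraph.Walk.support_map, List.mem_map] at hx
  obtain ⟨y, hy, rfl⟩ := hx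
  exact ⟨y, hp y hy, rfl⟩

theorem ReachableWithin.left_mem (h : ReachableWithin G U a b) : a ∈ U :=
  h.choose_spec _ (SimpleGraph.Walk.start_mem_support _)

theorem ReachableWithin.right_mem (h : ReachableWithin G U a b) : b ∈ U :=
  h.symm.left_mem

/-- The pairs `T (i, false)`, `T (i, true)` can be joined inside pairwise disjoint sets of vertices
that avoid `Z`. Indexing the terminals by `ι × Bool` lets a statement about all of them be made
without splitting each pair. -/
def LinkedAvoiding (G : SimpleGraph V) (T : ι × Bool → V) (Z : Set V) : Prop :=
  ∃ U : ι → Set V, Pairwise (Function.onFun Disjoint U) ∧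
    ∀ i, Disjoint (U i) Z ∧ ReachableWithin G (U i) (T (i, false)) (T (i, true))

theorem LinkedAvoiding.map {T : ι × Bool → V} (h : LinkedAvoiding G T Z) (f : G →g H)
    (hf : Function.Injective f) :
    LinkedAvoiding H (fun p => f (T p)) (f '' Zᶜ)ᶜ := by
  obtain ⟨U, hU, hUZ⟩ := h
  refine ⟨fun i => f '' U i, fun i j hij => Set.disjoint_image_of_injective hf (hU hij),
    fun i => ⟨?_, (hUZ i).2.map f⟩⟩
  exact Set.disjoint_compl_right_iff_subset.2
    (Set.image_mono (Set.subset_compl_iff_disjoint_right.2 (hUZ i).1))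

theorem LinkedAvoiding.mono {T : ι × Bool → V} (h : LinkedAvoiding G T Z') (hZ : Z ⊆ Z') :
    LinkedAvoiding G T Z := by
  obtain ⟨U, hU, hUZ⟩ := h
  exact ⟨U, hU, fun i => ⟨(hUZ i).1.mono_right hZ, (hUZ i).2⟩⟩

theorem LinkedAvoiding.extend {T T' : ι × Bool → V} {A : ι × Bool → Set V}
    (h : LinkedAvoiding G T' Z') (hA : Pairwise (Function.onFun Disjoint A))
    (hTA : ∀ p, ReachableWithin G (A p) (T p) (T' p)) (hAZ' : ∀ p, A p ⊆ insert (T' p) Z')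
    (hAZ : ∀ p, Disjoint (A p) Z) (hZ : Z ⊆ Z') : LinkedAvoiding G T Z := by
  obtain ⟨U, hU, hUZ⟩ := h
  have hend : ∀ i c, T' (i, c) ∈ U i := by
    rintro i (_ | _)
    exacts [(hUZ i).2.left_mem, (hUZ i).2.right_mem]
  have hUA : ∀ i j c, i ≠ j → Disjoint (U i) (A (j, c)) := by
    refine fun i j c hij => Set.disjoint_left.2 fun w hw hwA => ?_
    rcases hAZ' _ hwA with rfl | hwZ
    · exact Set.disjoint_left.1 (hU hij) hw (hend j c)
    · exact Set.disjoint_left.1 (hUZ i).1 hw hwZ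
  refine ⟨fun i => U i ∪ ⋃ c, A (i, c), fun i j hij => ?_, fun i => ⟨?_, ?_⟩⟩
  · simp only [Function.onFun, Set.disjoint_union_left, Set.disjoint_union_right,
      Set.disjoint_iUnion_left, Set.disjoint_iUnion_right]
    exact ⟨⟨hU hij, fun c => (hUA j i c hij.symm).symm⟩,
      fun c' => ⟨hUA i j c' hij, fun c => hA (by simp [hij])⟩⟩
  · simp only [Set.disjoint_union_left, Set.disjoint_iUnion_left]
    exact ⟨(hUZ i).1.mono_right hZ, fun c => hAZ (i, c)⟩
  · have hmove : ∀ c, ReachableWithin G (U i ∪ ⋃ c, A (i, c)) (T (i, c)) (T' (i, c)) := fun c =>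
      (hTA (i, c)).mono ((Set.subset_iUnion (fun c => A (i, c)) c).trans Set.subset_union_right)
    exact ((hmove false).trans ((hUZ i).2.mono Set.subset_union_left)).trans (hmove true).symm

theorem LinkedAvoiding.insertPair {T : ι × Bool → V} {R : Set V} {i₀ : ι}
    (h : LinkedAvoiding G (fun p : {i // i ≠ i₀} × Bool => T (p.1, p.2)) (Z ∪ R))
    (hRZ : Disjoint R Z) (hR : ReachableWithin G R (T (i₀, false)) (T (i₀, true))) :
    LinkedAvoiding G T Z := by
  classical
  obtain ⟨U, hU, hUZ⟩ := h
  simp only [Set.disjoint_union_right] at hUZ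
  refine ⟨fun i => if hi : i = i₀ then R else U ⟨i, hi⟩, fun i j hij => ?_, fun i => ?_⟩
  · by_cases hi : i = i₀ <;> by_cases hj : j = i₀
    · exact absurd (hi.trans hj.symm) hij
    · simpa [Function.onFun, hi, hj] using (hUZ ⟨j, hj⟩).1.2.symm
    · simpa [Function.onFun, hi, hj] using (hUZ ⟨i, hi⟩).1.2
    · simpa [Function.onFun, hi, hj] using hU (i := ⟨i, hi⟩) (j := ⟨j, hj⟩) (by simpa using hij)
  · by_cases hi : i = i₀
    · subst hi
      simpa using ⟨hRZ, hR⟩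
    · simpa [hi] using ⟨(hUZ ⟨i, hi⟩).1.1, (hUZ ⟨i, hi⟩).2⟩

theorem ReachableWithin.of_val {P : V → Prop} {H : SimpleGraph {x // P x}} {a b : {x // P x}}
    (h : ReachableWithin G U a b) (hH : G.comap Subtype.val ≤ H) (hU : ∀ x ∈ U, P x) :
    ReachableWithin H (Subtype.val ⁻¹' U) a b := by
  obtain ⟨p, hp⟩ := h
  have hwithin : ReachableWithin (G.induce {x | P x}) (Subtype.val ⁻¹' U) a b := by
    refine ⟨p.induce {x | P x} fun x hx => hU x (hp x hx), fun x hx => ?_⟩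
    rw [SimpleGraph.Walk.support_induce] at hx
    exact hp _ ((List.mem_attachWith ..).1 hx)
  exact (hwithin.map ⟨id, fun h => hH h⟩).mono (Set.image_id _).subset

theorem LinkedAvoiding.of_val {P : V → Prop} {H : SimpleGraph {x // P x}}
    {T : ι × Bool → {x // P x}} (h : LinkedAvoiding G (fun p => (T p).1) {x | ¬ P x})
    (hH : G.comap Subtype.val ≤ H) : LinkedAvoiding H T ∅ := by
  obtain ⟨U, hU, hUP⟩ := h
  exact ⟨fun i => Subtype.val ⁻¹' U i, fun i j hij => (hU hij).preimage _, fun i =>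
    ⟨disjoint_bot_right, (hUP i).2.of_val hH fun x hx =>
      not_not.1 (Set.disjoint_left.1 (hUP i).1 hx)⟩⟩

theorem isKLinked_of_linkedAvoiding {k : ℕ} (hcard : ((2 * k : ℕ) : ℕ∞) ≤ ENat.card V)
    (h : ∀ T : Fin k × Bool → V, Function.Injective T → LinkedAvoiding G T ∅) :
    G.IsKLinked k := by
  classical
  refine ⟨hcard, fun s t hst => ?_⟩
  obtain ⟨hs, ht, hne⟩ := Sum.elim_injective.1 hst
  obtain ⟨U, hU, hUst⟩ := h (fun p => if p.2 then t p.1 else s p.1) <| by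
    rintro ⟨i, _ | _⟩ ⟨j, _ | _⟩ hij
    exacts [congrArg (·, false) (hs hij), absurd hij (hne i j), absurd hij.symm (hne j i),
      congrArg (·, true) (ht hij)]
  choose p hp using fun i => (hUst i).2
  refine ⟨fun i => (p i).toPath, fun i j hij x hx hx' => ?_⟩
  exact Set.disjoint_left.1 (hU hij) (hp i x ((p i).support_toPath_subset_support hx))
    (hp j x ((p j).support_toPath_subset_support hx'))

end Linkage

section Counting

open Finset

variable {α β : Type*} [DecidableEq β]

theorem card_le_card_biUnion_of_card_le_union {C : Finset α} {F : α → Finset β} {s : Finset C}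
    (h₁ : ∀ a ∈ C, #C ≤ #(F a) + 1)
    (h₂ : ∀ a ∈ C, ∀ b ∈ C, a ≠ b → #C ≤ #(F a ∪ F b))
    (h₃ : ∀ a, C = {a} → (F a).Nonempty) : #s ≤ #(s.biUnion fun a => F a) := by
  obtain rfl | ⟨a, ha⟩ := s.eq_empty_or_nonempty
  · simp
  have hsub : ∀ b ∈ s, F b ⊆ s.biUnion fun a => F a := fun b hb =>
    subset_biUnion_of_mem (fun a : C => F a) hb
  have hle : #s ≤ #C := by simpa using card_le_univ s
  obtain hlt | heq := hle.lt_or_eq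
  · have := h₁ a a.2
    have := card_le_card (hsub a ha)
    omega
  obtain rfl : s = univ := by rwa [← card_eq_iff_eq_univ, Fintype.card_coe]
  by_cases hb : ∃ b ∈ C, b ≠ a
  · obtain ⟨b, hb, hba⟩ := hb
    exact hle.trans ((h₂ a a.2 b hb hba.symm).trans
      (card_le_card (union_subset (hsub a ha) (hsub ⟨b, hb⟩ (mem_univ _)))))
  · push Not at hb
    have hC : C = {a.1} := eq_singleton_iff_unique_mem.2 ⟨a.2, hb⟩
    have hcard : #C = 1 := by rw [hC, card_singleton]
    have := (h₃ a hC).card_pos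
    have := card_le_card (hsub a ha)
    omega

theorem exists_injOn_of_card_le_union [Nonempty β] {C : Finset α} {F : α → Finset β}
    (h₁ : ∀ a ∈ C, #C ≤ #(F a) + 1)
    (h₂ : ∀ a ∈ C, ∀ b ∈ C, a ≠ b → #C ≤ #(F a ∪ F b))
    (h₃ : ∀ a, C = {a} → (F a).Nonempty) :
    ∃ f : α → β, (∀ a ∈ C, f a ∈ F a) ∧ Set.InjOn f C := by
  obtain ⟨f, hf, hfF⟩ := (all_card_le_biUnion_card_iff_exists_injective fun a : C => F a).1
    fun _ => card_le_card_biUnion_of_card_le_union h₁ h₂ h₃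
  have hext : ∀ a : C, Function.extend Subtype.val f (fun _ => Classical.arbitrary β) a = f a :=
    fun a => Subtype.val_injective.extend_apply f _ a
  refine ⟨Function.extend Subtype.val f fun _ => Classical.arbitrary β, fun a ha => ?_, ?_⟩
  · simpa only [hext ⟨a, ha⟩] using hfF ⟨a, ha⟩
  · intro a ha b hb hab
    rw [hext ⟨a, ha⟩, hext ⟨b, hb⟩] at hab
    exact congrArg Subtype.val (hf hab)

theorem tight_of_subset_union_biUnion {N A : Finset β} {X : Finset α} {B : α → Finset β}
    (hcover : N ⊆ A ∪ X.biUnion B) (hB : ∀ p ∈ X, #(N ∩ B p) ≤ 1) (hcard : #A + #X ≤ #N) :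
    #N = #A + #X ∧ A ⊆ N ∧ ∀ p ∈ X, (N ∩ B p).Nonempty := by
  have hle : #N ≤ #(N ∩ A) + ∑ p ∈ X, #(N ∩ B p) := by
    calc #N = #(N ∩ (A ∪ X.biUnion B)) := by rw [inter_eq_left.2 hcover]
      _ ≤ #(N ∩ A) + #(X.biUnion fun p => N ∩ B p) := by
        rw [inter_union_distrib_left, inter_biUnion]
        exact card_union_le _ _
      _ ≤ #(N ∩ A) + ∑ p ∈ X, #(N ∩ B p) := by gcongr; exact card_biUnion_le
  have hA : #(N ∩ A) ≤ #A := card_le_card inter_subset_right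
  have hX : ∑ p ∈ X, #(N ∩ B p) ≤ #X := by simpa using sum_le_card_nsmul X _ 1 hB
  refine ⟨by omega, inter_eq_right.1 (eq_of_subset_of_card_le inter_subset_right (by omega)),
    fun p hp => ?_⟩
  by_contra hempty
  have hpos : ∑ q ∈ X, #(N ∩ B q) < #X := by
    simpa using sum_lt_sum hB ⟨p, hp, by rw [not_nonempty_iff_eq_empty.1 hempty]; simp⟩
  omega

end Counting

namespace BoolCube

open Finset

section Cube

variable {n : ℕ} {e f : Fin n} {b : Bool} {x y w : Fin n → Bool}

/-- The neighbour of `x` in direction `e`. -/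
def flipAt (e : Fin n) (x : Fin n → Bool) : Fin n → Bool := Function.update x e (!x e)

@[simp] theorem flipAt_same (e : Fin n) (x : Fin n → Bool) : flipAt e x e = !x e := by
  simp [flipAt]

theorem flipAt_of_ne (h : f ≠ e) (x : Fin n → Bool) : flipAt e x f = x f := by
  simp [flipAt, h]

@[simp] theorem flipAt_flipAt (e : Fin n) (x : Fin n → Bool) : flipAt e (flipAt e x) = x := by
  simp [flipAt]

theorem flipAt_ne_self (e : Fin n) (x : Fin n → Bool) : flipAt e x ≠ x := fun h => by
  simpa using congrFun h e

theorem flipAt_left_injective (x : Fin n → Bool) : Function.Injective fun e => flipAt e x := by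
  intro e f h
  by_contra hne
  simpa [flipAt_of_ne hne] using congrFun h e

theorem flipAt_injective (e : Fin n) : Function.Injective (flipAt e) := fun x y h => by
  simpa using congrArg (flipAt e) h

theorem flipAt_ne_flipAt_flipAt (e f g : Fin n) (x : Fin n → Bool) :
    flipAt e x ≠ flipAt f (flipAt g x) := fun h => by
  have he := congrFun h e
  have hf := congrFun h f
  have hg := congrFun h g
  simp only [flipAt, Function.update_apply] at he hf hg
  grind

theorem flipAt_apply_eq_of_ne (h : x e ≠ b) : flipAt e x e = b := by
  rw [flipAt_same]
  exact (Bool.eq_not_of_ne h.symm).symm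

theorem update_flipAt_same (e : Fin n) (b : Bool) (x : Fin n → Bool) :
    Function.update (flipAt e x) e b = Function.update x e b := by
  simp [flipAt]

theorem update_eq_self_of_apply (h : x e = b) : Function.update x e b = x := by
  rw [← h, Function.update_eq_self]

theorem flipAt_update_of_ne (h : x e ≠ b) : flipAt e (Function.update x e b) = x := by
  simp [flipAt, Bool.eq_not_of_ne h]

theorem update_eq_flipAt_of_ne (h : x e ≠ b) : Function.update x e b = flipAt e x := by
  rw [← flipAt_flipAt e (Function.update x e b), flipAt_update_of_ne h]

/-- The graph of the `n`-cube. -/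
def cube (n : ℕ) : SimpleGraph (Fin n → Bool) where
  Adj x y := ∃ e, y = flipAt e x
  symm := ⟨fun x y ⟨e, h⟩ => ⟨e, by simp [h]⟩⟩
  loopless := ⟨fun x ⟨e, h⟩ => flipAt_ne_self e x h.symm⟩

theorem cube_adj_flipAt (e : Fin n) (x : Fin n → Bool) : (cube n).Adj x (flipAt e x) := ⟨e, rfl⟩

theorem hammingDist_flipAt_le (e : Fin n) (x : Fin n → Bool) : hammingDist x (flipAt e x) ≤ 1 := by
  unfold hammingDist
  refine (card_le_card (t := {e}) fun i hi => ?_).trans (card_singleton e).le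
  by_contra hne
  exact (mem_filter.1 hi).2 (flipAt_of_ne (by simpa using hne) x).symm

theorem hammingDist_update_le (e : Fin n) (b : Bool) (x : Fin n → Bool) :
    hammingDist x (Function.update x e b) ≤ 1 := by
  by_cases h : x e = b
  · simp [update_eq_self_of_apply h]
  · simpa only [update_eq_flipAt_of_ne h] using hammingDist_flipAt_le e x

theorem hammingDist_opposite (x : Fin n → Bool) : hammingDist x (opposite x) = n := by
  simp [hammingDist, opposite]

/-- The neighbours of `x` in directions other than `e`, that is, inside the facet of `x` orthogonal
to `e`. -/
def nbrs (e : Fin n) (x : Fin n → Bool) : Finset (Fin n → Bool) :=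
  (univ.erase e).image fun f => flipAt f x

theorem mem_nbrs : y ∈ nbrs e x ↔ ∃ f, f ≠ e ∧ flipAt f x = y := by
  simp [nbrs]

theorem card_nbrs_add_one (e : Fin n) (x : Fin n → Bool) : #(nbrs e x) + 1 = n := by
  rw [nbrs, card_image_of_injective _ (flipAt_left_injective x), card_erase_add_one (mem_univ e),
    card_univ, Fintype.card_fin]

theorem nbrs_apply_same (h : y ∈ nbrs e x) : y e = x e := by
  obtain ⟨f, hf, rfl⟩ := mem_nbrs.1 h
  exact flipAt_of_ne hf.symm x

theorem adj_of_mem_nbrs (h : y ∈ nbrs e x) : (cube n).Adj x y := by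
  obtain ⟨f, -, rfl⟩ := mem_nbrs.1 h
  exact cube_adj_flipAt f x

theorem mem_nbrs_comm : y ∈ nbrs e x ↔ x ∈ nbrs e y := by
  simp only [mem_nbrs]
  constructor <;> rintro ⟨f, hf, rfl⟩ <;> exact ⟨f, hf, flipAt_flipAt f _⟩

theorem notMem_nbrs_self (e : Fin n) (x : Fin n → Bool) : x ∉ nbrs e x := fun h =>
  (adj_of_mem_nbrs h).ne rfl

theorem disjoint_nbrs (h : y ∈ nbrs e x) : Disjoint (nbrs e x) (nbrs e y) := by
  rw [Finset.disjoint_left]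
  intro w hw hw'
  obtain ⟨f, -, rfl⟩ := mem_nbrs.1 h
  obtain ⟨g, -, rfl⟩ := mem_nbrs.1 hw
  obtain ⟨k, -, hk⟩ := mem_nbrs.1 hw'
  exact flipAt_ne_flipAt_flipAt _ _ _ _ hk.symm

theorem hammingDist_le_of_mem_nbrs (h : y ∈ nbrs e x) : hammingDist x y ≤ 1 := by
  obtain ⟨f, -, rfl⟩ := mem_nbrs.1 h
  exact hammingDist_flipAt_le f x

end Cube

section Facet

variable {m : ℕ} {e : Fin (m + 1)} {b : Bool} {x y : Fin (m + 1) → Bool}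
  {S : Finset (Fin (m + 1) → Bool)}

/-- The inclusion of the facet `x e = b` of the cube, as a graph homomorphism. -/
def facetHom (e : Fin (m + 1)) (b : Bool) : cube m →g cube (m + 1) where
  toFun x := e.insertNth b x
  map_rel' := by
    rintro x _ ⟨f, rfl⟩
    exact ⟨e.succAbove f, by simp [flipAt, Fin.insertNth_update]⟩

theorem facetHom_flipAt (e : Fin (m + 1)) (b : Bool) (f : Fin m) (x : Fin m → Bool) :
    facetHom e b (flipAt f x) = flipAt (e.succAbove f) (facetHom e b x) := by
  simp [facetHom, flipAt, Fin.insertNth_update]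

theorem facetHom_apply_same (e : Fin (m + 1)) (b : Bool) (x : Fin m → Bool) :
    facetHom e b x e = b := by
  simp [facetHom]

theorem facetHom_injective (e : Fin (m + 1)) (b : Bool) : Function.Injective (facetHom e b) :=
  Fin.insertNth_right_injective (α := fun _ => Bool) b

theorem facetHom_removeNth (h : x e = b) : facetHom e b (e.removeNth x) = x := by
  subst h
  exact Fin.insertNth_self_removeNth e x

/-- The trace of a set of vertices on a facet, which is identified with the `m`-cube. -/
def facetTrace (e : Fin (m + 1)) (b : Bool) (S : Finset (Fin (m + 1) → Bool)) :
    Finset (Fin m → Bool) :=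
  univ.filter fun u => facetHom e b u ∈ S

theorem mem_facetTrace {u : Fin m → Bool} : u ∈ facetTrace e b S ↔ facetHom e b u ∈ S := by
  simp [facetTrace]

theorem removeNth_mem_facetTrace (h : x e = b) : e.removeNth x ∈ facetTrace e b S ↔ x ∈ S := by
  rw [mem_facetTrace, facetHom_removeNth h]

theorem card_facetTrace_le (e : Fin (m + 1)) (b : Bool) (S : Finset (Fin (m + 1) → Bool)) :
    #(facetTrace e b S) ≤ #(S.filter (· e = b)) :=
  card_le_card_of_injOn (facetHom e b)
    (fun u hu => mem_filter.2 ⟨mem_facetTrace.1 hu, facetHom_apply_same e b u⟩)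
    (facetHom_injective e b).injOn

theorem reachableWithin_facet (hx : x e = b) (hy : y e = b)
    (h : ReachableWithin (cube m) {w | w ∉ facetTrace e b S} (e.removeNth x) (e.removeNth y)) :
    ReachableWithin (cube (m + 1)) {w | w e = b ∧ w ∉ S} x y := by
  have h' := h.map (facetHom e b)
  rw [facetHom_removeNth hx, facetHom_removeNth hy] at h'
  refine h'.mono ?_
  rintro _ ⟨w, hw, rfl⟩
  exact ⟨facetHom_apply_same e b w, mt mem_facetTrace.2 hw⟩

theorem linkedAvoiding_facet {ι : Type*} {T : ι × Bool → Fin (m + 1) → Bool} (hT : ∀ p, T p e = b)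
    (h : LinkedAvoiding (cube m) (fun p => e.removeNth (T p)) {w | w ∈ facetTrace e b S}) :
    LinkedAvoiding (cube (m + 1)) T {w | w e = b → w ∈ S} := by
  have h' := h.map (facetHom e b) (facetHom_injective e b)
  simp only [facetHom_removeNth (hT _)] at h'
  refine h'.mono ?_
  rintro _ hw ⟨u, hu, rfl⟩
  exact hu (mem_facetTrace.2 (hw (facetHom_apply_same e b u)))

end Facet

section Connectivity

variable {m : ℕ}

theorem exists_two_mul_card_filter_le (e : Fin m) (S : Finset (Fin m → Bool)) :
    ∃ b, 2 * #(S.filter (· e = b)) ≤ #S := by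
  have hsum : #(S.filter (· e = true)) + #(S.filter (· e = false)) = #S := by
    simpa using card_filter_add_card_filter_not (s := S) (· e = true)
  rcases le_total #(S.filter (· e = true)) #(S.filter (· e = false)) with h | h
  exacts [⟨true, by omega⟩, ⟨false, by omega⟩]

theorem exists_flipAt_notMem_of_card_lt {e : Fin m} {c : Bool} {A S : Finset (Fin m → Bool)}
    (hA : ∀ v ∈ A, v e = c) (hcard : #S < #A) : ∃ v ∈ A, v ∉ S ∧ flipAt e v ∉ S := by
  by_contra! hall
  have hsub : A ⊆ S.image fun v => Function.update v e c := fun v hv => by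
    by_cases hvS : v ∈ S
    · exact mem_image.2 ⟨v, hvS, update_eq_self_of_apply (hA v hv)⟩
    · exact mem_image.2 ⟨_, hall v hv hvS, by
        rw [update_flipAt_same, update_eq_self_of_apply (hA v hv)]⟩
  exact hcard.not_ge ((card_le_card hsub).trans card_image_le)

theorem exists_reachableWithin_apply_eq {e : Fin m} {b : Bool} {x : Fin m → Bool}
    {A S : Finset (Fin m → Bool)} (hxb : x e ≠ b) (hA : ∀ v ∈ A, v e = x e) (hcard : #S < #A)
    (hxA : ∀ v ∈ A, v ∉ S → ReachableWithin (cube m) {w | w ∉ S} x v) :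
    ∃ u, u e = b ∧ ReachableWithin (cube m) {w | w ∉ S} x u := by
  obtain ⟨v, hv, hvS, hvS'⟩ := exists_flipAt_notMem_of_card_lt hA hcard
  exact ⟨flipAt e v, flipAt_apply_eq_of_ne (by rwa [hA v hv]),
    (hxA v hv hvS).trans (.of_adj (cube_adj_flipAt e v) hvS hvS')⟩

theorem reachableWithin_of_card_le (S : Finset (Fin m → Bool)) (hS : #S ≤ m - 1)
    {x y : Fin m → Bool} (hx : x ∉ S) (hy : y ∉ S) :
    ReachableWithin (cube m) {w | w ∉ S} x y := by
  induction m with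
  | zero => rw [Subsingleton.elim y x]; exact .refl hx
  | succ m ih =>
    obtain ⟨b, hb⟩ := exists_two_mul_card_filter_le 0 S
    have hescape : ∀ x, x ∉ S → ∃ u, u 0 = b ∧ ReachableWithin (cube (m + 1)) {w | w ∉ S} x u := by
      intro x hx
      by_cases hxb : x 0 = b
      · exact ⟨x, hxb, .refl hx⟩
      refine exists_reachableWithin_apply_eq (A := insert x (nbrs 0 x)) hxb ?_ ?_ ?_
      · exact (forall_mem_insert _ _ _).2 ⟨rfl, fun v hv => nbrs_apply_same hv⟩
      · rw [card_insert_of_notMem (notMem_nbrs_self 0 x), card_nbrs_add_one]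
        omega
      · exact (forall_mem_insert _ _ _).2
          ⟨fun hx => .refl hx, fun v hv hvS => .of_adj (adj_of_mem_nbrs hv) hx hvS⟩
    obtain ⟨u, hub, hxu⟩ := hescape x hx
    obtain ⟨v, hvb, hyv⟩ := hescape y hy
    have huv : ReachableWithin (cube (m + 1)) {w | w 0 = b ∧ w ∉ S} u v :=
      reachableWithin_facet hub hvb <| ih _ ((card_facetTrace_le 0 b S).trans (by omega))
        (mt (removeNth_mem_facetTrace hub).1 hxu.right_mem)
        (mt (removeNth_mem_facetTrace hvb).1 hyv.right_mem)
    exact (hxu.trans (huv.mono fun _ h => h.2)).trans hyv.symm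

theorem reachableWithin_of_exists_flipAt (S : Finset (Fin m → Bool)) (hS : #S + 3 ≤ 2 * m)
    {x y : Fin m → Bool} (hx : x ∉ S) (hy : y ∉ S) (hx' : ∃ f, flipAt f x ∉ S)
    (hy' : ∃ f, flipAt f y ∉ S) : ReachableWithin (cube m) {w | w ∉ S} x y := by
  obtain _ | m := m
  · omega
  obtain ⟨b, hb⟩ := exists_two_mul_card_filter_le 0 S
  have hescape : ∀ x, x ∉ S → (∃ f, flipAt f x ∉ S) →
      ∃ u, u 0 = b ∧ ReachableWithin (cube (m + 1)) {w | w ∉ S} x u := by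
    rintro x hx ⟨f, hf⟩
    have hxf := ReachableWithin.of_adj (U := {w | w ∉ S}) (cube_adj_flipAt f x) hx hf
    by_cases hxb : x 0 = b
    · exact ⟨x, hxb, .refl hx⟩
    by_cases hf0 : f = 0
    · subst hf0
      exact ⟨_, flipAt_apply_eq_of_ne hxb, hxf⟩
    have hfx : flipAt f x ∈ nbrs 0 x := mem_nbrs.2 ⟨f, hf0, rfl⟩
    refine exists_reachableWithin_apply_eq (A := nbrs 0 x ∪ nbrs 0 (flipAt f x)) hxb ?_ ?_ ?_
    · exact fun v hv => (mem_union.1 hv).elim nbrs_apply_same fun hv =>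
        (nbrs_apply_same hv).trans (nbrs_apply_same hfx)
    · have := card_nbrs_add_one 0 x
      have := card_nbrs_add_one 0 (flipAt f x)
      rw [card_union_of_disjoint (disjoint_nbrs hfx)]
      omega
    · exact fun v hv hvS => (mem_union.1 hv).elim
        (fun hv => .of_adj (adj_of_mem_nbrs hv) hx hvS)
        fun hv => hxf.trans (.of_adj (adj_of_mem_nbrs hv) hf hvS)
  obtain ⟨u, hub, hxu⟩ := hescape x hx hx'
  obtain ⟨v, hvb, hyv⟩ := hescape y hy hy'
  have huv : ReachableWithin (cube (m + 1)) {w | w 0 = b ∧ w ∉ S} u v :=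
    reachableWithin_facet hub hvb <| reachableWithin_of_card_le _
      ((card_facetTrace_le 0 b S).trans (by omega))
      (mt (removeNth_mem_facetTrace hub).1 hxu.right_mem)
      (mt (removeNth_mem_facetTrace hvb).1 hyv.right_mem)
  exact (hxu.trans (huv.mono fun _ h => h.2)).trans hyv.symm

theorem reachableWithin_facet_of_not_subset {e : Fin (m + 1)} {b : Bool}
    {S : Finset (Fin (m + 1) → Bool)} (hS : #S + 3 ≤ 2 * m) {x y : Fin (m + 1) → Bool}
    (hxb : x e = b) (hyb : y e = b) (hx : x ∉ S) (hy : y ∉ S)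
    (hx' : ¬ nbrs e x ⊆ S) (hy' : ¬ nbrs e y ⊆ S) :
    ReachableWithin (cube (m + 1)) {w | w e = b ∧ w ∉ S} x y := by
  have hfree : ∀ u : Fin (m + 1) → Bool, u e = b → ¬ nbrs e u ⊆ S →
      ∃ f, flipAt f (e.removeNth u) ∉ facetTrace e b S := by
    intro u hu h
    obtain ⟨w, hw, hwS⟩ := Finset.not_subset.1 h
    obtain ⟨g, hg, rfl⟩ := mem_nbrs.1 hw
    obtain ⟨f, rfl⟩ := Fin.exists_succAbove_eq hg
    exact ⟨f, by rwa [mem_facetTrace, facetHom_flipAt, facetHom_removeNth hu]⟩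
  have hcard := (card_facetTrace_le e b S).trans (card_filter_le S _)
  exact reachableWithin_facet hxb hyb <| reachableWithin_of_exists_flipAt _ (by omega)
    (mt (removeNth_mem_facetTrace hxb).1 hx) (mt (removeNth_mem_facetTrace hyb).1 hy)
    (hfree x hxb hx') (hfree y hyb hy')

end Connectivity

section Sparse

variable {n : ℕ} {ι : Type*} {e : Fin n} {b : Bool}

theorem opposite_opposite (x : Fin n → Bool) : opposite (opposite x) = x := by
  funext i
  simp [opposite]

theorem opposite_apply_eq_of_ne {x : Fin n → Bool} (h : x e ≠ b) : opposite x e = b :=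
  (Bool.eq_not_of_ne h.symm).symm

theorem le_hammingDist_of_update_mem {x z : Fin n → Bool}
    (h : Function.update (opposite z) e b ∈ insert x (nbrs e x)) : n - 2 ≤ hammingDist x z := by
  have hx : hammingDist x (Function.update (opposite z) e b) ≤ 1 := by
    rcases mem_insert.1 h with h | h
    · simp [h]
    · exact hammingDist_le_of_mem_nbrs h
  have hupdate := hammingDist_update_le e b (opposite z)
  have hopp := hammingDist_opposite z
  have htri := hammingDist_triangle z x (opposite z)
  have htri' := hammingDist_triangle x (Function.update (opposite z) e b) (opposite z)
  rw [hammingDist_comm] at hupdate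
  rw [hammingDist_comm z x] at htri
  omega

theorem exists_update_notMem (hn : 4 ≤ n) {x y z : Fin n → Bool}
    (hx : x ∉ ({z, opposite z} : Finset (Fin n → Bool)))
    (hy : y ∉ ({z, opposite z} : Finset (Fin n → Bool))) :
    ∃ u ∈ ({x, y} : Finset (Fin n → Bool)), ∃ z' ∈ ({z, opposite z} : Finset (Fin n → Bool)),
      Function.update z' e (x e) ∉ {x, y} ∪ nbrs e u := by
  wlog hz : z e = x e generalizing z
  · simpa only [opposite_opposite, pair_comm (opposite z) z] using
      this (z := opposite z) (by simpa only [opposite_opposite, pair_comm] using hx)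
        (by simpa only [opposite_opposite, pair_comm] using hy) (opposite_apply_eq_of_ne hz)
  have hzxy : z ∉ ({x, y} : Finset (Fin n → Bool)) := by
    simp only [mem_insert, mem_singleton, not_or] at hx hy ⊢
    exact ⟨Ne.symm hx.1, Ne.symm hy.1⟩
  by_cases hnear : z ∈ nbrs e x ∧ z ∈ nbrs e y
  · have hfar : ∀ v, z ∈ nbrs e v →
        Function.update (opposite z) e (x e) ∉ insert v (nbrs e v) := fun v hv h => by
      have := le_hammingDist_of_update_mem h
      have := hammingDist_le_of_mem_nbrs hv
      omega
    have hfarx := hfar x hnear.1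
    have hfary := hfar y hnear.2
    simp only [mem_insert, not_or] at hfarx hfary
    exact ⟨x, by simp, opposite z, by simp, by simp [hfarx, hfary.1]⟩
  · obtain ⟨u, hu, hzu⟩ : ∃ u ∈ ({x, y} : Finset (Fin n → Bool)), z ∉ nbrs e u := by
      rw [not_and_or] at hnear
      simpa using hnear
    refine ⟨u, hu, z, by simp, ?_⟩
    rw [update_eq_self_of_apply hz]
    exact notMem_union.2 ⟨hzxy, hzu⟩

section Points

variable [Fintype ι] {T : ι × Bool → Fin n → Bool} {Z : Finset (Fin n → Bool)}

/-- The terminals together with the forbidden vertices. -/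
def points (T : ι × Bool → Fin n → Bool) (Z : Finset (Fin n → Bool)) : Finset (Fin n → Bool) :=
  univ.image T ∪ Z

/-- Distinct terminals in a cube of dimension at least four, off the forbidden set `Z`, for which a
linkage can be found by induction on the number of pairs. The antipodal alternative is the case of
the link of a vertex, which has one point too many for the first one if `n` is even. -/
structure IsSparse (T : ι × Bool → Fin n → Bool) (Z : Finset (Fin n → Bool)) : Prop where
  injective : Function.Injective T
  notMem : ∀ p, T p ∉ Z
  four_le : 4 ≤ n
  card : 2 * Fintype.card ι + #Z ≤ n + 1 ∨
    2 * Fintype.card ι ≤ n ∧ 6 ≤ n ∧ ∃ z, Z = {z, opposite z}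

theorem mem_points {w : Fin n → Bool} : w ∈ points T Z ↔ (∃ p, T p = w) ∨ w ∈ Z := by
  simp [points]

theorem apply_mem_points (p : ι × Bool) : T p ∈ points T Z := mem_points.2 (.inl ⟨p, rfl⟩)

theorem card_points_le : #(points T Z) ≤ 2 * Fintype.card ι + #Z := by
  refine (card_union_le _ _).trans (Nat.add_le_add_right (card_image_le.trans ?_) _)
  simp [mul_comm]

/-- The projection of all terminals and forbidden vertices to the facet `x e = b`. -/
def shadow (T : ι × Bool → Fin n → Bool) (Z : Finset (Fin n → Bool)) (e : Fin n) (b : Bool) :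
    Finset (Fin n → Bool) :=
  (points T Z).image fun w => Function.update w e b

theorem update_mem_shadow {w : Fin n → Bool} (hw : w ∈ points T Z) (e : Fin n) (b : Bool) :
    Function.update w e b ∈ shadow T Z e b := mem_image_of_mem _ hw

theorem mem_shadow_of_apply {w : Fin n → Bool} (hw : w ∈ points T Z) (hb : w e = b) :
    w ∈ shadow T Z e b := by
  simpa only [update_eq_self_of_apply hb] using update_mem_shadow hw e b

namespace IsSparse

theorem card_filter_le (h : IsSparse T Z) (e : Fin n) (b : Bool) :
    2 * Fintype.card ι + #(Z.filter (· e = b)) ≤ n + 1 := by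
  rcases h.card with h | ⟨h, -, z, rfl⟩
  · exact (Nat.add_le_add_left (Finset.card_filter_le _ _) _).trans h
  · have hone : #(({z, opposite z} : Finset (Fin n → Bool)).filter (· e = b)) ≤ 1 := by
      by_cases hz : z e = b
      · simp [filter_insert, filter_singleton, opposite, hz]
      · simp only [filter_insert, filter_singleton, hz, if_false]
        split_ifs <;> simp
    omega

theorem card_le (h : IsSparse T Z) {A : Finset (Fin n → Bool)} (hA : A ⊆ points T Z)
    (hZ : ∀ z, Z = {z, opposite z} → ¬ Z ⊆ A) : #A ≤ n + 1 := by
  have hpoints := card_points_le (T := T) (Z := Z)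
  rcases h.card with hc | ⟨hc, -, z, hz⟩
  · exact (card_le_card hA).trans (by omega)
  · have hss : A ⊂ points T Z :=
      hA.ssubset_of_ne fun h' => hZ z hz (h' ▸ subset_union_right)
    have := card_lt_card hss
    have : #Z ≤ 2 := hz ▸ card_le_two
    omega

theorem exists_flipAt_notMem (h : IsSparse T Z) {i₀ : ι}
    (hi : ∀ e, T (i₀, true) e ≠ T (i₀, false) e) :
    ∃ e, flipAt e (T (i₀, true)) ∉ points T Z := by
  by_contra! hall
  have hn := h.four_le
  set s := T (i₀, false)
  set t := T (i₀, true)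
  set N := univ.image fun e => flipAt e t with hN
  have hdist : ∀ w ∈ insert t N, hammingDist t w ≤ 1 := by
    simp [hN, hammingDist_flipAt_le]
  have hs : s ∉ insert t N := fun hs => by
    have := hdist s hs
    have : hammingDist t s = n := by simp [hammingDist, hi]
    omega
  have ht : t ∉ N := by simp [hN, flipAt_ne_self]
  have hcard : #(insert s (insert t N)) = n + 2 := by
    rw [card_insert_of_notMem hs, card_insert_of_notMem ht, hN,
      card_image_of_injective _ (flipAt_left_injective t), card_univ, Fintype.card_fin]
  have hsub : insert s (insert t N) ⊆ points T Z :=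
    insert_subset (apply_mem_points _) (insert_subset (apply_mem_points _)
      (image_subset_iff.2 fun e _ => hall e))
  refine absurd (h.card_le hsub fun z hz hZ => ?_) (by omega)
  have hnear : ∀ w ∈ Z, hammingDist t w ≤ 1 := fun w hw =>
    hdist w ((mem_insert.1 (hZ hw)).resolve_left fun hws => h.notMem (i₀, false) (hws ▸ hw : s ∈ Z))
  have hz₁ := hnear z (by simp [hz])
  have hz₂ := hnear (opposite z) (by simp [hz])
  have htri := hammingDist_triangle z t (opposite z)
  rw [hammingDist_opposite, hammingDist_comm z t] at htri
  omega

end IsSparse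

end Points

section Conflicts

variable [Fintype ι] [DecidableEq ι] {T : ι × Bool → Fin n → Bool} {Z : Finset (Fin n → Bool)}
  {i₀ : ι} {p q : ι × Bool}

/-- The terminals of the pairs other than `i₀` that lie on the side of `T (i₀, false)` and cannot
leave that side directly. -/
def conflicts (T : ι × Bool → Fin n → Bool) (Z : Finset (Fin n → Bool)) (e : Fin n) (i₀ : ι) :
    Finset (ι × Bool) :=
  univ.filter fun p => p.1 ≠ i₀ ∧ T p e = T (i₀, false) e ∧ flipAt e (T p) ∈ points T Z

/-- The only conflict is at a terminal that cannot be moved to a neighbour in its facet which lies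
off the shadow. -/
def IsBlocked (T : ι × Bool → Fin n → Bool) (Z : Finset (Fin n → Bool)) (e : Fin n) (i₀ : ι) :
    Prop :=
  ∃ p, conflicts T Z e i₀ = {p} ∧ nbrs e (T p) ⊆ shadow T Z e (T p e)

/-- A choice of distinct neighbours in the facet, off the shadow, to which the conflicting terminals
can be moved before they leave the facet. -/
structure IsMove (T : ι × Bool → Fin n → Bool) (Z : Finset (Fin n → Bool)) (e : Fin n) (i₀ : ι)
    (f : ι × Bool → Fin n → Bool) : Prop where
  mem_nbrs : ∀ p ∈ conflicts T Z e i₀, f p ∈ nbrs e (T p)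
  notMem_shadow : ∀ p ∈ conflicts T Z e i₀, f p ∉ shadow T Z e (T (i₀, false) e)
  injOn : Set.InjOn f (conflicts T Z e i₀)

theorem mem_conflicts : p ∈ conflicts T Z e i₀ ↔
    p.1 ≠ i₀ ∧ T p e = T (i₀, false) e ∧ flipAt e (T p) ∈ points T Z := by
  simp [conflicts]

theorem card_add_card_le_of_card_inter_le {x : Fin n → Bool} {P A : Finset (Fin n → Bool)} {c : ℕ}
    (hAP : A ⊆ P) (hA : Disjoint A (nbrs e x)) (hcard : #(P ∩ (A ∪ nbrs e x)) + c ≤ n + 1) :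
    c + #A ≤ #(nbrs e x \ P) + 2 := by
  rw [inter_union_distrib_left, inter_eq_right.2 hAP,
    card_union_of_disjoint (hA.mono_right inter_subset_right)] at hcard
  have hN := card_nbrs_add_one e x
  have hsplit := card_inter_add_card_sdiff (nbrs e x) P
  rw [inter_comm] at hsplit
  omega

namespace IsSparse

theorem card_shadow_add_card_conflicts_le (h : IsSparse T Z) (e : Fin n) (i₀ : ι) :
    #(shadow T Z e (T (i₀, false) e)) + #(conflicts T Z e i₀) ≤ 2 * Fintype.card ι + #Z := by
  set b := T (i₀, false) e
  set B := (conflicts T Z e i₀).image fun p => flipAt e (T p) with hB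
  have hBsub : B ⊆ points T Z := image_subset_iff.2 fun p hp => (mem_conflicts.1 hp).2.2
  have hBcard : #B = #(conflicts T Z e i₀) :=
    card_image_of_injective _ ((flipAt_injective e).comp h.injective)
  have hBe : ∀ w ∈ B, w e ≠ b := by
    simp only [hB, forall_mem_image, flipAt_same]
    exact fun p hp => (mem_conflicts.1 hp).2.1 ▸ Bool.not_ne_self _
  have hsub : shadow T Z e b ⊆ (points T Z \ B).image fun w => Function.update w e b := by
    refine image_subset_iff.2 fun w hw => ?_
    by_cases hwB : w ∈ B
    · obtain ⟨p, hp, rfl⟩ := mem_image.1 hwB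
      have hpb := (mem_conflicts.1 hp).2.1
      rw [update_flipAt_same]
      exact mem_image_of_mem _ (mem_sdiff.2 ⟨apply_mem_points p, fun h' => hBe _ h' hpb⟩)
    · exact mem_image_of_mem _ (mem_sdiff.2 ⟨hw, hwB⟩)
  have hcard := (card_le_card hsub).trans card_image_le
  rw [card_sdiff_of_subset hBsub] at hcard
  have := card_le_card hBsub
  have := card_points_le (T := T) (Z := Z)
  omega

theorem exists_card_inter_le (h : IsSparse T Z) (hp : T p e = T (i₀, false) e) (q : ι × Bool) :
    ∃ u ∈ ({T p, T q} : Finset (Fin n → Bool)),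
      #(shadow T Z e (T (i₀, false) e) ∩ ({T p, T q} ∪ nbrs e u)) + #(conflicts T Z e i₀)
        ≤ n + 1 := by
  have hcount := h.card_shadow_add_card_conflicts_le e i₀
  rcases h.card with hc | ⟨hc, -, z, hz⟩
  · have := card_le_card (inter_subset_left (s₁ := shadow T Z e (T (i₀, false) e))
      (s₂ := {T p, T q} ∪ nbrs e (T p)))
    exact ⟨T p, by simp, by omega⟩
  · obtain ⟨u, hu, z', hz', hfar⟩ := exists_update_notMem (e := e) h.four_le
      (hz ▸ h.notMem p) (hz ▸ h.notMem q)
    rw [hp] at hfar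
    have hlt : #(shadow T Z e (T (i₀, false) e) ∩ ({T p, T q} ∪ nbrs e u)) <
        #(shadow T Z e (T (i₀, false) e)) :=
      card_lt_card <| (ssubset_iff_of_subset inter_subset_left).2
        ⟨_, update_mem_shadow (mem_points.2 (.inr (hz ▸ hz'))) _ _,
          fun h' => hfar (mem_inter.1 h').2⟩
    have : #Z ≤ 2 := hz ▸ card_le_two
    exact ⟨u, hu, by omega⟩

theorem card_conflicts_le_of_notMem_nbrs (h : IsSparse T Z) (hp : T p e = T (i₀, false) e)
    (hq : T q e = T (i₀, false) e) (hpq : T q ∉ nbrs e (T p)) :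
    ∃ u ∈ ({T p, T q} : Finset (Fin n → Bool)),
      #(conflicts T Z e i₀) + #{T p, T q} ≤ #(nbrs e u \ shadow T Z e (T (i₀, false) e)) + 2 := by
  obtain ⟨u, hu, hcard⟩ := h.exists_card_inter_le hp q
  refine ⟨u, hu, card_add_card_le_of_card_inter_le ?_ ?_ hcard⟩
  · simp [insert_subset_iff, mem_shadow_of_apply, apply_mem_points, hp, hq]
  · have hqp := mt mem_nbrs_comm.1 hpq
    simp only [mem_insert, mem_singleton] at hu
    rcases hu with rfl | rfl <;> simp [hpq, hqp, notMem_nbrs_self]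

theorem card_conflicts_le (h : IsSparse T Z) (hp : T p e = T (i₀, false) e) :
    #(conflicts T Z e i₀) ≤ #(nbrs e (T p) \ shadow T Z e (T (i₀, false) e)) + 1 := by
  simpa using h.card_conflicts_le_of_notMem_nbrs hp hp (notMem_nbrs_self e _)

theorem card_conflicts_le_card_union (h : IsSparse T Z) (hp : p ∈ conflicts T Z e i₀)
    (hq : q ∈ conflicts T Z e i₀) (hpq : p ≠ q) :
    #(conflicts T Z e i₀) ≤ #(nbrs e (T p) \ shadow T Z e (T (i₀, false) e) ∪
      nbrs e (T q) \ shadow T Z e (T (i₀, false) e)) := by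
  have hp' := (mem_conflicts.1 hp).2.1
  have hq' := (mem_conflicts.1 hq).2.1
  by_cases hadj : T q ∈ nbrs e (T p)
  · have := h.card_conflicts_le hp'
    have := h.card_conflicts_le hq'
    have : 2 ≤ #(conflicts T Z e i₀) := by
      rw [← card_pair hpq]
      exact card_le_card (by simp [insert_subset_iff, hp, hq])
    rw [card_union_of_disjoint ((disjoint_nbrs hadj).mono sdiff_subset sdiff_subset)]
    omega
  · obtain ⟨u, hu, hcard⟩ := h.card_conflicts_le_of_notMem_nbrs hp' hq' hadj
    rw [card_pair (h.injective.ne hpq), Nat.add_le_add_iff_right] at hcard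
    refine hcard.trans (card_le_card ?_)
    simp only [mem_insert, mem_singleton] at hu
    rcases hu with rfl | rfl
    exacts [subset_union_left, subset_union_right]

theorem exists_isMove (h : IsSparse T Z) (hblocked : ¬ IsBlocked T Z e i₀) :
    ∃ f, IsMove T Z e i₀ f := by
  obtain ⟨f, hf, hinj⟩ := exists_injOn_of_card_le_union (C := conflicts T Z e i₀)
    (F := fun p => nbrs e (T p) \ shadow T Z e (T (i₀, false) e))
    (fun p hp => h.card_conflicts_le (mem_conflicts.1 hp).2.1)
    (fun p hp q hq hpq => h.card_conflicts_le_card_union hp hq hpq) fun p hC => by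
      have hp := (mem_conflicts.1 (hC ▸ mem_singleton_self p)).2.1
      exact sdiff_nonempty.2 fun hN => hblocked ⟨p, hC, hp ▸ hN⟩
  exact ⟨f, fun p hp => (mem_sdiff.1 (hf p hp)).1, fun p hp => (mem_sdiff.1 (hf p hp)).2, hinj⟩

end IsSparse

end Conflicts

section Blocked

variable [Fintype ι] {T : ι × Bool → Fin n → Bool} {Z : Finset (Fin n → Bool)} {p : ι × Bool}
  {w w' : Fin n → Bool}

/-- The terminals and forbidden vertices that project to `x` or to a neighbour of `x` in its facet
orthogonal to `e`. -/
def cluster (T : ι × Bool → Fin n → Bool) (Z : Finset (Fin n → Bool)) (e : Fin n)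
    (x : Fin n → Bool) : Finset (Fin n → Bool) :=
  (points T Z).filter fun w => Function.update w e (x e) ∈ insert x (nbrs e x)

theorem mem_cluster {x : Fin n → Bool} : w ∈ cluster T Z e x ↔
    w ∈ points T Z ∧ Function.update w e (x e) ∈ insert x (nbrs e x) := mem_filter

theorem hammingDist_le_two_of_mem_cluster {x : Fin n → Bool} (hw : w ∈ cluster T Z e x) :
    hammingDist x w ≤ 2 := by
  have hproj : hammingDist x (Function.update w e (x e)) ≤ 1 := by
    rcases mem_insert.1 (mem_cluster.1 hw).2 with hx | hx
    · simp [hx]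
    · exact hammingDist_le_of_mem_nbrs hx
  have hupdate := hammingDist_update_le e (x e) w
  have htri := hammingDist_triangle_right x w (Function.update w e (x e))
  omega

namespace IsSparse

theorem exists_notMem_cluster (h : IsSparse T Z) (e : Fin n) (p : ι × Bool) {z : Fin n → Bool}
    (hz : Z = {z, opposite z}) : ∃ z' ∈ Z, z' ∉ cluster T Z e (T p) := by
  obtain ⟨u, hu, z', hz', hfar⟩ :=
    exists_update_notMem h.four_le (e := e) (hz ▸ h.notMem p) (hz ▸ h.notMem p)
  obtain rfl : u = T p := by simpa using hu
  refine ⟨z', hz ▸ hz', fun hmem => hfar ?_⟩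
  simpa using (mem_cluster.1 hmem).2

theorem card_cluster_le (h : IsSparse T Z) (e : Fin n) (p : ι × Bool) :
    #(cluster T Z e (T p)) ≤ n + 1 :=
  h.card_le (filter_subset _ _) fun _ hz hsub =>
    have ⟨_, hz', hfar⟩ := h.exists_notMem_cluster e p hz
    hfar (hsub hz')

/-- The cluster of a blocked terminal projects onto `n` vertices, even without `flipAt e (T p)`,
which leaves no room for two of its points to share their projection. -/
theorem cluster_tight (h : IsSparse T Z) (hflip : flipAt e (T p) ∈ points T Z)
    (hN : nbrs e (T p) ⊆ shadow T Z e (T p e)) :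
    #(cluster T Z e (T p)) = n + 1 ∧
      Set.InjOn (fun w : Fin n → Bool => Function.update w e (T p e))
        ((cluster T Z e (T p)).erase (flipAt e (T p))) := by
  have hcard := h.card_cluster_le e p
  set x := T p
  have hfx : Function.update (flipAt e x) e (x e) = x := by
    rw [update_flipAt_same, Function.update_eq_self]
  set A := (cluster T Z e x).erase (flipAt e x)
  have hflipmem : flipAt e x ∈ cluster T Z e x := mem_cluster.2 ⟨hflip, by simp [hfx]⟩
  have hAcard : #A + 1 = #(cluster T Z e x) := card_erase_add_one hflipmem
  have hsub : insert x (nbrs e x) ⊆ A.image fun w => Function.update w e (x e) := by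
    intro y hy
    obtain ⟨w, hw, hwflip, rfl⟩ :
        ∃ w ∈ points T Z, w ≠ flipAt e x ∧ Function.update w e (x e) = y := by
      rcases mem_insert.1 hy with rfl | hy
      · exact ⟨x, apply_mem_points p, (flipAt_ne_self e x).symm, Function.update_eq_self e x⟩
      · obtain ⟨w, hw, rfl⟩ := mem_image.1 (hN hy)
        exact ⟨w, hw, fun hwf => notMem_nbrs_self e x (by simpa [hwf, hfx] using hy), rfl⟩
    exact mem_image_of_mem _ (mem_erase.2 ⟨hwflip, mem_cluster.2 ⟨hw, hy⟩⟩)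
  have hn : #(insert x (nbrs e x)) = n := by
    rw [card_insert_of_notMem (notMem_nbrs_self e x), card_nbrs_add_one]
  have hle := card_le_card hsub
  have himage := card_image_le (s := A) (f := fun w => Function.update w e (x e))
  exact ⟨by omega, card_image_iff.1 (by omega)⟩

theorem mem_cluster_or_le_hammingDist (h : IsSparse T Z) (hflip : flipAt e (T p) ∈ points T Z)
    (hN : nbrs e (T p) ⊆ shadow T Z e (T p e)) (hw : w ∈ points T Z) :
    w ∈ cluster T Z e (T p) ∨ w ∈ Z ∧ 4 ≤ hammingDist (T p) w := by
  have hcard := (h.cluster_tight hflip hN).1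
  have hpoints := card_points_le (T := T) (Z := Z)
  have hsub : cluster T Z e (T p) ⊆ points T Z := filter_subset _ _
  rcases h.card with hc | ⟨hc, hn, z₀, hz₀⟩
  · exact .inl (by rwa [eq_of_subset_of_card_le hsub (by omega)])
  obtain ⟨z, hz, hfar⟩ := h.exists_notMem_cluster e p hz₀
  have hZ : #Z ≤ 2 := hz₀ ▸ card_le_two
  have hpts : insert z (cluster T Z e (T p)) = points T Z :=
    eq_of_subset_of_card_le (insert_subset (mem_points.2 (.inr hz)) hsub)
      (by rw [card_insert_of_notMem hfar]; omega)
  rw [← hpts, mem_insert] at hw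
  refine hw.symm.imp_right ?_
  rintro rfl
  have hopp : opposite w ∈ points T Z := mem_points.2 <| .inr <| by
    rw [hz₀, mem_insert, mem_singleton] at hz ⊢
    rcases hz with rfl | rfl
    exacts [.inr rfl, .inl (opposite_opposite _)]
  have hne : opposite w ≠ w := fun h' => by
    have := hammingDist_opposite w
    rw [h', hammingDist_self] at this
    omega
  rw [← hpts, mem_insert, or_iff_right hne] at hopp
  have := le_hammingDist_of_update_mem (mem_cluster.1 hopp).2
  exact ⟨hz, by omega⟩

theorem apply_mem_cluster (h : IsSparse T Z) (hflip : flipAt e (T p) ∈ points T Z)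
    (hN : nbrs e (T p) ⊆ shadow T Z e (T p e)) (q : ι × Bool) : T q ∈ cluster T Z e (T p) :=
  (h.mem_cluster_or_le_hammingDist hflip hN (apply_mem_points q)).resolve_right
    fun hq => h.notMem q hq.1

theorem eq_of_update_mem_nbrs (h : IsSparse T Z) (hflip : flipAt e (T p) ∈ points T Z)
    (hN : nbrs e (T p) ⊆ shadow T Z e (T p e)) (hw : w ∈ points T Z) (hw' : w' ∈ points T Z)
    (hmem : Function.update w e (T p e) ∈ nbrs e (T p))
    (heq : Function.update w e (T p e) = Function.update w' e (T p e)) : w = w' := by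
  have hmemA : ∀ v ∈ points T Z, Function.update v e (T p e) ∈ nbrs e (T p) →
      v ∈ (cluster T Z e (T p)).erase (flipAt e (T p)) := fun v hv hvN => by
    refine mem_erase.2 ⟨?_, mem_cluster.2 ⟨hv, mem_insert_of_mem hvN⟩⟩
    rintro rfl
    rw [update_flipAt_same, Function.update_eq_self] at hvN
    exact notMem_nbrs_self e _ hvN
  exact (h.cluster_tight hflip hN).2 (hmemA w hw hmem) (hmemA w' hw' (heq ▸ hmem)) heq

theorem exists_flipAt_eq_of_nbrs_subset (h : IsSparse T Z) (hflip : flipAt e (T p) ∈ points T Z)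
    (hN : nbrs e (T p) ⊆ shadow T Z e (T p e)) {q : ι × Bool} (hqe : T q e = T p e) (hqp : q ≠ p) :
    ∃ g, flipAt g (T p) = T q ∧ ∀ w ∈ cluster T Z e (T p), w ≠ T q → w g = T p g := by
  have hq := (mem_cluster.1 (h.apply_mem_cluster hflip hN q)).2
  rw [update_eq_self_of_apply hqe] at hq
  replace hq := (mem_insert.1 hq).resolve_left (h.injective.ne hqp)
  obtain ⟨g, hg, hgq⟩ := mem_nbrs.1 hq
  refine ⟨g, hgq, fun w hw hwq => ?_⟩
  have hwg : Function.update w e (T p e) g = w g := Function.update_of_ne hg _ _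
  obtain ⟨hwP, hw⟩ := mem_cluster.1 hw
  rcases mem_insert.1 hw with hw | hw
  · rw [← hwg, hw]
  obtain ⟨f, -, hfw⟩ := mem_nbrs.1 hw
  have hgf : g ≠ f := by
    rintro rfl
    refine hwq (h.eq_of_update_mem_nbrs hflip hN hwP (apply_mem_points q) hw ?_)
    rw [update_eq_self_of_apply hqe, ← hgq, hfw]
  rw [← hwg, ← hfw, flipAt_of_ne hgf]

end IsSparse

end Blocked

section Linking

variable {T f : ι × Bool → Fin n → Bool} {Z : Finset (Fin n → Bool)} {i₀ : ι} {p q : ι × Bool}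
  {a : Fin n → Bool}

/-- The projections of the two terminals of the pair `i₀` to the facet of the first one. -/
def foot (T : ι × Bool → Fin n → Bool) (e : Fin n) (i₀ : ι) (c : Bool) : Fin n → Bool :=
  Function.update (T (i₀, c)) e (T (i₀, false) e)

theorem foot_apply_same (T : ι × Bool → Fin n → Bool) (e : Fin n) (i₀ : ι) (c : Bool) :
    foot T e i₀ c e = T (i₀, false) e := Function.update_self ..

theorem foot_false (T : ι × Bool → Fin n → Bool) (e : Fin n) (i₀ : ι) :
    foot T e i₀ false = T (i₀, false) := Function.update_eq_self ..

variable [Fintype ι]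

theorem foot_mem_shadow (c : Bool) : foot T e i₀ c ∈ shadow T Z e (T (i₀, false) e) :=
  update_mem_shadow (apply_mem_points _) _ _

/-- The terminal `T (i₀, true)` is on the side of `T (i₀, false)`, or it can step over directly. -/
def CanCross (T : ι × Bool → Fin n → Bool) (Z : Finset (Fin n → Bool)) (e : Fin n) (i₀ : ι) :
    Prop :=
  T (i₀, true) e ≠ T (i₀, false) e → flipAt e (T (i₀, true)) ∉ points T Z

theorem CanCross.foot_eq_of_mem_points (h : CanCross T Z e i₀) {c : Bool}
    (hc : foot T e i₀ c ∈ points T Z) : foot T e i₀ c = T (i₀, c) := by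
  cases c with
  | false => exact foot_false T e i₀
  | true =>
    by_cases hne : T (i₀, true) e = T (i₀, false) e
    · exact update_eq_self_of_apply hne
    · rw [foot, update_eq_flipAt_of_ne hne] at hc
      exact absurd hc (h hne)

variable [DecidableEq ι]

/-- The terminals of the pairs other than `i₀` that lie on the side of `T (i₀, false)`. -/
def nearTerminals (T : ι × Bool → Fin n → Bool) (e : Fin n) (i₀ : ι) : Finset (ι × Bool) :=
  univ.filter fun p => p.1 ≠ i₀ ∧ T p e = T (i₀, false) e

theorem mem_nearTerminals : p ∈ nearTerminals T e i₀ ↔ p.1 ≠ i₀ ∧ T p e = T (i₀, false) e := by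
  simp [nearTerminals]

theorem card_filter_fst_ne_add_two (i₀ : ι) :
    #(univ.filter fun p : ι × Bool => p.1 ≠ i₀) + 2 = 2 * Fintype.card ι := by
  have hprod : (univ.filter fun p : ι × Bool => p.1 ≠ i₀) = (univ.erase i₀) ×ˢ univ := by
    ext p
    simp
  have := card_erase_add_one (mem_univ i₀)
  rw [card_univ] at this
  rw [hprod, card_product, card_univ, Fintype.card_bool]
  omega

theorem nearTerminals_subset : nearTerminals T e i₀ ⊆ univ.filter fun p => p.1 ≠ i₀ :=
  monotone_filter_right _ fun _ _ hp => hp.1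

/-- All other terminals are on the side of `T (i₀, false)`, and one of the two feet is surrounded by
exactly these terminals and the forbidden vertices in the facet. -/
def IsIsolated (T : ι × Bool → Fin n → Bool) (Z : Finset (Fin n → Bool)) (e : Fin n) (i₀ : ι) :
    Prop :=
  (∀ p, p.1 ≠ i₀ → T p e = T (i₀, false) e) ∧ ∃ c, nbrs e (foot T e i₀ c) =
    Z.filter (· e = T (i₀, false) e) ∪ (nearTerminals T e i₀).image T

/-- The vertex of the facet of `T (i₀, false)` through which the terminal `T p` is routed to the
opposite facet. -/
def landing (T : ι × Bool → Fin n → Bool) (Z : Finset (Fin n → Bool)) (e : Fin n) (i₀ : ι)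
    (f : ι × Bool → Fin n → Bool) (p : ι × Bool) : Fin n → Bool :=
  if p ∈ conflicts T Z e i₀ then f p else Function.update (T p) e (T (i₀, false) e)

/-- The vertices of the facet of `T (i₀, false)` that the path between the feet has to avoid. -/
def occupied (T : ι × Bool → Fin n → Bool) (Z : Finset (Fin n → Bool)) (e : Fin n) (i₀ : ι)
    (f : ι × Bool → Fin n → Bool) : Finset (Fin n → Bool) :=
  Z.filter (· e = T (i₀, false) e) ∪
    (nearTerminals T e i₀).biUnion fun p => {T p, landing T Z e i₀ f p}

/-- The vertices used to bring the terminal `T p` to the facet opposite to `T (i₀, false)`. -/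
def route (T : ι × Bool → Fin n → Bool) (Z : Finset (Fin n → Bool)) (e : Fin n) (i₀ : ι)
    (f : ι × Bool → Fin n → Bool) (p : ι × Bool) : Set (Fin n → Bool) :=
  {w | w = flipAt e (landing T Z e i₀ f p) ∨
    T p e = T (i₀, false) e ∧ (w = T p ∨ w = landing T Z e i₀ f p)}

/-- The vertices open to the path that joins the pair `i₀`. -/
def corridor (T : ι × Bool → Fin n → Bool) (Z : Finset (Fin n → Bool)) (e : Fin n) (i₀ : ι)
    (f : ι × Bool → Fin n → Bool) : Set (Fin n → Bool) :=
  insert (T (i₀, true)) {w | w e = T (i₀, false) e ∧ w ∉ occupied T Z e i₀ f}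

theorem landing_of_mem (hp : p ∈ conflicts T Z e i₀) : landing T Z e i₀ f p = f p := if_pos hp

theorem landing_of_notMem (hp : p ∉ conflicts T Z e i₀) :
    landing T Z e i₀ f p = Function.update (T p) e (T (i₀, false) e) := if_neg hp

theorem landing_of_apply_eq (hpe : T p e = T (i₀, false) e) (hp : p ∉ conflicts T Z e i₀) :
    landing T Z e i₀ f p = T p := by
  rw [landing_of_notMem hp, update_eq_self_of_apply hpe]

theorem flipAt_landing_of_apply_ne (hpe : T p e ≠ T (i₀, false) e) :
    flipAt e (landing T Z e i₀ f p) = T p := by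
  rw [landing_of_notMem fun hp => hpe (mem_conflicts.1 hp).2.1, flipAt_update_of_ne hpe]

namespace IsMove

theorem landing_apply_same (hf : IsMove T Z e i₀ f) (p : ι × Bool) :
    landing T Z e i₀ f p e = T (i₀, false) e := by
  by_cases hp : p ∈ conflicts T Z e i₀
  · rw [landing_of_mem hp, nbrs_apply_same (hf.mem_nbrs p hp), (mem_conflicts.1 hp).2.1]
  · rw [landing_of_notMem hp, Function.update_self]

theorem landing_mem_shadow_iff (hf : IsMove T Z e i₀ f) :
    landing T Z e i₀ f p ∈ shadow T Z e (T (i₀, false) e) ↔ p ∉ conflicts T Z e i₀ := by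
  by_cases hp : p ∈ conflicts T Z e i₀
  · simpa [hp, landing_of_mem hp] using hf.notMem_shadow p hp
  · simpa [hp, landing_of_notMem hp] using update_mem_shadow (apply_mem_points p) e _

theorem landing_eq_of_mem_points (hf : IsMove T Z e i₀ f) (hpe : T p e = T (i₀, false) e)
    (h : landing T Z e i₀ f p ∈ points T Z) : landing T Z e i₀ f p = T p :=
  landing_of_apply_eq hpe
    (hf.landing_mem_shadow_iff.1 (mem_shadow_of_apply h (hf.landing_apply_same p)))

theorem flipAt_landing_eq_of_mem_points (hf : IsMove T Z e i₀ f) (hp : p.1 ≠ i₀)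
    (h : flipAt e (landing T Z e i₀ f p) ∈ points T Z) :
    flipAt e (landing T Z e i₀ f p) = T p := by
  by_cases hpe : T p e = T (i₀, false) e
  · have hpC : p ∉ conflicts T Z e i₀ := by
      rw [← hf.landing_mem_shadow_iff]
      simpa only [update_flipAt_same, update_eq_self_of_apply (hf.landing_apply_same p)] using
        update_mem_shadow h e (T (i₀, false) e)
    rw [landing_of_apply_eq hpe hpC] at h
    exact absurd (mem_conflicts.2 ⟨hp, hpe, h⟩) hpC
  · exact flipAt_landing_of_apply_ne hpe

theorem landing_injOn (hf : IsMove T Z e i₀ f) (hT : Function.Injective T) :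
    Set.InjOn (landing T Z e i₀ f) {p | p.1 ≠ i₀} := by
  intro p hp q hq hpq
  have hC : p ∈ conflicts T Z e i₀ ↔ q ∈ conflicts T Z e i₀ := by
    rw [← not_iff_not, ← hf.landing_mem_shadow_iff, ← hf.landing_mem_shadow_iff, hpq]
  by_cases hpC : p ∈ conflicts T Z e i₀
  · rw [landing_of_mem hpC, landing_of_mem (hC.1 hpC)] at hpq
    exact hf.injOn hpC (hC.1 hpC) hpq
  have hqC := mt hC.2 hpC
  refine hT ?_
  by_cases hpe : T p e = T (i₀, false) e <;> by_cases hqe : T q e = T (i₀, false) e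
  · rwa [landing_of_apply_eq hpe hpC, landing_of_apply_eq hqe hqC] at hpq
  · have hflip : flipAt e (landing T Z e i₀ f p) = T q := hpq ▸ flipAt_landing_of_apply_ne hqe
    rw [← hflip, hf.flipAt_landing_eq_of_mem_points hp (hflip ▸ apply_mem_points q)]
  · have hflip : flipAt e (landing T Z e i₀ f q) = T p := hpq ▸ flipAt_landing_of_apply_ne hpe
    rw [← hflip, hf.flipAt_landing_eq_of_mem_points hq (hflip ▸ apply_mem_points p)]
  · rw [← flipAt_landing_of_apply_ne (f := f) (Z := Z) hpe,
      ← flipAt_landing_of_apply_ne (f := f) (Z := Z) hqe, hpq]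

theorem flipAt_landing_apply_ne (hf : IsMove T Z e i₀ f) (p : ι × Bool) :
    flipAt e (landing T Z e i₀ f p) e ≠ T (i₀, false) e := by
  rw [flipAt_same, hf.landing_apply_same]
  exact Bool.not_ne_self _

theorem reachableWithin_route (hf : IsMove T Z e i₀ f) (p : ι × Bool) :
    ReachableWithin (cube n) (route T Z e i₀ f p) (T p) (flipAt e (landing T Z e i₀ f p)) := by
  by_cases hpe : T p e = T (i₀, false) e
  · refine .trans (b := landing T Z e i₀ f p) ?_
      (.of_adj (cube_adj_flipAt _ _) (.inr ⟨hpe, .inr rfl⟩) (.inl rfl))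
    by_cases hpC : p ∈ conflicts T Z e i₀
    · refine .of_adj ?_ (.inr ⟨hpe, .inl rfl⟩) (.inr ⟨hpe, .inr rfl⟩)
      rw [landing_of_mem hpC]
      exact adj_of_mem_nbrs (hf.mem_nbrs p hpC)
    · rw [landing_of_apply_eq hpe hpC]
      exact .refl (.inr ⟨hpe, .inl rfl⟩)
  · rw [flipAt_landing_of_apply_ne hpe]
    exact .refl (.inl (flipAt_landing_of_apply_ne hpe).symm)

theorem apply_eq_of_mem_route (hf : IsMove T Z e i₀ f) {w : Fin n → Bool}
    (hw : w ∈ route T Z e i₀ f p) :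
    w = flipAt e (landing T Z e i₀ f p) ∨ w e = T (i₀, false) e := by
  refine hw.imp_right ?_
  rintro ⟨hpe, rfl | rfl⟩
  exacts [hpe, hf.landing_apply_same p]

theorem eq_of_mem_route_of_mem_points (hf : IsMove T Z e i₀ f) (hp : p.1 ≠ i₀) {w : Fin n → Bool}
    (hw : w ∈ route T Z e i₀ f p) (hwP : w ∈ points T Z) : w = T p := by
  rcases hw with rfl | ⟨hpe, rfl | rfl⟩
  exacts [hf.flipAt_landing_eq_of_mem_points hp hwP, rfl, hf.landing_eq_of_mem_points hpe hwP]

theorem disjoint_route (hf : IsMove T Z e i₀ f) (hT : Function.Injective T) (hp : p.1 ≠ i₀)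
    (hq : q.1 ≠ i₀) (hpq : p ≠ q) :
    Disjoint (route T Z e i₀ f p) (route T Z e i₀ f q) := by
  refine Set.disjoint_left.2 fun w hwp hwq => ?_
  have hland : landing T Z e i₀ f p ≠ landing T Z e i₀ f q :=
    (hf.landing_injOn hT).ne hp hq hpq
  by_cases hwP : w ∈ points T Z
  · exact hpq <| hT <| (hf.eq_of_mem_route_of_mem_points hp hwp hwP).symm.trans
      (hf.eq_of_mem_route_of_mem_points hq hwq hwP)
  have hnear : ∀ {r}, w ∈ route T Z e i₀ f r → w e = T (i₀, false) e →
      w = landing T Z e i₀ f r := by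
    rintro r (rfl | ⟨-, rfl | rfl⟩) hwe
    exacts [absurd hwe (hf.flipAt_landing_apply_ne r), absurd (apply_mem_points r) hwP, rfl]
  by_cases hwe : w e = T (i₀, false) e
  · exact hland ((hnear hwp hwe).symm.trans (hnear hwq hwe))
  · exact hland <| flipAt_injective e <|
      ((hf.apply_eq_of_mem_route hwp).resolve_right hwe).symm.trans
        ((hf.apply_eq_of_mem_route hwq).resolve_right hwe)

end IsMove

theorem mem_occupied {w : Fin n → Bool} : w ∈ occupied T Z e i₀ f ↔
    w ∈ Z ∧ w e = T (i₀, false) e ∨ ∃ p, (p.1 ≠ i₀ ∧ T p e = T (i₀, false) e) ∧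
      (w = T p ∨ w = landing T Z e i₀ f p) := by
  simp only [occupied, mem_union, mem_filter, mem_biUnion, mem_nearTerminals, mem_insert,
    mem_singleton]

theorem occupied_of_conflicts_eq_empty (h : conflicts T Z e i₀ = ∅) : occupied T Z e i₀ f =
    Z.filter (· e = T (i₀, false) e) ∪ (nearTerminals T e i₀).image T := by
  rw [occupied, ← biUnion_singleton]
  congr 1
  refine biUnion_congr rfl fun p hp => ?_
  rw [landing_of_apply_eq (mem_nearTerminals.1 hp).2 (h ▸ notMem_empty p), pair_eq_singleton]

namespace IsMove

theorem card_nbrs_inter_pair_le_one (hf : IsMove T Z e i₀ f) (x : Fin n → Bool)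
    (hpe : T p e = T (i₀, false) e) : #(nbrs e x ∩ {T p, landing T Z e i₀ f p}) ≤ 1 := by
  by_cases hpC : p ∈ conflicts T Z e i₀
  · rw [landing_of_mem hpC]
    by_cases hTp : T p ∈ nbrs e x
    · have hfp : f p ∉ nbrs e x := fun hfp =>
        Finset.disjoint_left.1 (disjoint_nbrs hTp) hfp (hf.mem_nbrs p hpC)
      simp [inter_insert_of_mem hTp, inter_singleton_of_notMem hfp]
    · rw [inter_insert_of_notMem hTp]
      exact (card_le_card inter_subset_right).trans (card_singleton _).le
  · rw [landing_of_apply_eq hpe hpC, pair_eq_singleton]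
    exact (card_le_card inter_subset_right).trans (card_singleton _).le

theorem hammingDist_le_two (hf : IsMove T Z e i₀ f) {x : Fin n → Bool}
    (hpe : T p e = T (i₀, false) e)
    (hx : (nbrs e x ∩ {T p, landing T Z e i₀ f p}).Nonempty) : hammingDist x (T p) ≤ 2 := by
  obtain ⟨w, hw⟩ := hx
  rw [mem_inter, mem_insert, mem_singleton] at hw
  have hxw := hammingDist_le_of_mem_nbrs hw.1
  have hpw : hammingDist (T p) w ≤ 1 := by
    rcases hw.2 with rfl | rfl
    · simp
    · by_cases hpC : p ∈ conflicts T Z e i₀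
      · rw [landing_of_mem hpC]
        exact hammingDist_le_of_mem_nbrs (hf.mem_nbrs p hpC)
      · simp [landing_of_apply_eq hpe hpC]
  have := hammingDist_triangle_right x (T p) w
  omega

end IsMove

namespace IsSparse

theorem occupied_subset (h : IsSparse T Z) (hcross : CanCross T Z e i₀) :
    occupied T Z e i₀ f ⊆
      (shadow T Z e (T (i₀, false) e)) \ {foot T e i₀ false, foot T e i₀ true} ∪
        (conflicts T Z e i₀).image f := by
  have hpoints : ∀ w ∈ points T Z, w e = T (i₀, false) e → (∀ c, w ≠ T (i₀, c)) →
      w ∈ (shadow T Z e (T (i₀, false) e)) \ {foot T e i₀ false, foot T e i₀ true} := by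
    intro w hw hwe hne
    have hfoot : ∀ c, w ≠ foot T e i₀ c := by
      rintro c rfl
      exact hne c (hcross.foot_eq_of_mem_points hw)
    simp [mem_shadow_of_apply hw hwe, hfoot]
  have hterminal : ∀ p : ι × Bool, p.1 ≠ i₀ → ∀ c, T p ≠ T (i₀, c) := fun p hp c hpc =>
    hp (congrArg Prod.fst (h.injective hpc))
  intro w hw
  rw [mem_union]
  rcases mem_occupied.1 hw with ⟨hwZ, hwe⟩ | ⟨p, ⟨hp, hpe⟩, rfl | rfl⟩
  · exact .inl (hpoints w (mem_points.2 (.inr hwZ)) hwe fun c hwc => h.notMem _ (hwc ▸ hwZ))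
  · exact .inl (hpoints _ (apply_mem_points p) hpe (hterminal p hp))
  · by_cases hpC : p ∈ conflicts T Z e i₀
    · exact .inr (landing_of_mem (f := f) hpC ▸ mem_image_of_mem _ hpC)
    · rw [landing_of_apply_eq hpe hpC]
      exact .inl (hpoints _ (apply_mem_points p) hpe (hterminal p hp))

theorem foot_notMem_occupied (h : IsSparse T Z) (hf : IsMove T Z e i₀ f)
    (hcross : CanCross T Z e i₀) (c : Bool) : foot T e i₀ c ∉ occupied T Z e i₀ f := by
  intro hc
  rcases mem_union.1 (h.occupied_subset hcross hc) with hc | hc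
  · cases c <;> simp at hc
  · obtain ⟨p, hp, hpc⟩ := mem_image.1 hc
    exact hf.notMem_shadow p hp (hpc ▸ foot_mem_shadow c)

theorem card_occupied_add_two_le (h : IsSparse T Z) (hcross : CanCross T Z e i₀) :
    #(occupied T Z e i₀ f) + 2 ≤ 2 * Fintype.card ι + #Z := by
  have hne : foot T e i₀ false ≠ foot T e i₀ true := by
    rw [foot_false]
    intro heq
    exact h.injective.ne (by simp)
      (heq.trans (hcross.foot_eq_of_mem_points (heq ▸ apply_mem_points _)))
  have hfeet : {foot T e i₀ false, foot T e i₀ true} ⊆ shadow T Z e (T (i₀, false) e) :=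
    insert_subset (foot_mem_shadow _) (singleton_subset_iff.2 (foot_mem_shadow _))
  have hsub := (card_le_card (h.occupied_subset (f := f) hcross)).trans (card_union_le _ _)
  rw [card_sdiff_of_subset hfeet, card_pair hne] at hsub
  have htwo := card_le_card hfeet
  rw [card_pair hne] at htwo
  have := card_image_le (s := conflicts T Z e i₀) (f := f)
  have := h.card_shadow_add_card_conflicts_le e i₀
  omega

theorem card_occupied_add_five_le (h : IsSparse T Z) (hcross : CanCross T Z e i₀) :
    #(occupied T Z e i₀ f) + 5 ≤ 2 * n := by
  have := h.card_occupied_add_two_le (f := f) hcross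
  have := h.four_le
  rcases h.card with hc | ⟨hc, hn, z, rfl⟩
  · omega
  · have := card_le_two (a := z) (b := opposite z)
    omega

theorem conflicts_eq_empty_of_near (h : IsSparse T Z) (hcross : CanCross T Z e i₀)
    (hside : ∀ p, p.1 ≠ i₀ → T p e = T (i₀, false) e)
    (hnear : ∀ p, p.1 ≠ i₀ → hammingDist a (T p) ≤ 2)
    (hZ : Z.filter (· e = T (i₀, false) e) ⊆ nbrs e a)
    (hcard : n + 1 ≤ 2 * Fintype.card ι + #(Z.filter (· e = T (i₀, false) e))) :
    conflicts T Z e i₀ = ∅ := by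
  refine eq_empty_of_forall_notMem fun p hp => ?_
  obtain ⟨hp₀, hpe, hflip⟩ := mem_conflicts.1 hp
  have hfe : flipAt e (T p) e ≠ T (i₀, false) e := by
    rw [flipAt_same, hpe]
    exact Bool.not_ne_self _
  rcases mem_points.1 hflip with ⟨⟨i, c⟩, hq⟩ | hz
  · by_cases hi : i = i₀
    · subst hi
      cases c with
      | false => exact hfe (hq ▸ rfl)
      | true => exact hcross (hq ▸ hfe) (by rw [hq, flipAt_flipAt]; exact apply_mem_points p)
    · exact hfe (hq ▸ hside (i, c) hi)
  rcases h.card with hc | ⟨-, hn, z, hz'⟩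
  · have hlt : #(Z.filter (· e = T (i₀, false) e)) < #Z :=
      card_lt_card (filter_ssubset.2 ⟨_, hz, hfe⟩)
    omega
  have hopp : opposite (flipAt e (T p)) ∈ Z := by
    rw [hz', mem_insert, mem_singleton] at hz ⊢
    rcases hz with hz | hz <;> simp [hz, opposite_opposite]
  have hadj := hammingDist_le_of_mem_nbrs
    (hZ (mem_filter.2 ⟨hopp, by simp [opposite, hpe]⟩))
  have hflip_le := hammingDist_flipAt_le e (T p)
  have htri := hammingDist_triangle a (T p) (flipAt e (T p))
  have htri' := hammingDist_triangle_left (flipAt e (T p)) (opposite (flipAt e (T p))) a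
  rw [hammingDist_opposite] at htri'
  have := hnear p hp₀
  omega

/-- Each terminal and its landing account for at most one neighbour of the foot, so the count is
tight: all other terminals lie on this side and none of them is moved. -/
theorem isIsolated_of_nbrs_subset (h : IsSparse T Z) (hf : IsMove T Z e i₀ f)
    (hcross : CanCross T Z e i₀) {c : Bool}
    (hc : nbrs e (foot T e i₀ c) ⊆ occupied T Z e i₀ f) : IsIsolated T Z e i₀ := by
  set N := nbrs e (foot T e i₀ c)
  have hNcard : #N + 1 = n := card_nbrs_add_one _ _
  have hfilter := h.card_filter_le e (T (i₀, false) e)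
  have hothers := card_filter_fst_ne_add_two i₀
  have hnear := nearTerminals_subset (T := T) (e := e) (i₀ := i₀)
  have hnear_le := card_le_card hnear
  obtain ⟨hcard, hZN, hmeet⟩ := tight_of_subset_union_biUnion hc
    (fun p hp => hf.card_nbrs_inter_pair_le_one _ (mem_nearTerminals.1 hp).2) (by omega)
  have hall := eq_of_subset_of_card_le hnear (by omega)
  have hside : ∀ p, p.1 ≠ i₀ → p ∈ nearTerminals T e i₀ := fun p hp =>
    hall ▸ mem_filter.2 ⟨mem_univ p, hp⟩
  have hempty : conflicts T Z e i₀ = ∅ := h.conflicts_eq_empty_of_near hcross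
    (fun p hp => (mem_nearTerminals.1 (hside p hp)).2)
    (fun p hp => hf.hammingDist_le_two (mem_nearTerminals.1 (hside p hp)).2 (hmeet p (hside p hp)))
    hZN (by omega)
  refine ⟨fun p hp => (mem_nearTerminals.1 (hside p hp)).2, c, Subset.antisymm ?_ ?_⟩
  · rwa [← occupied_of_conflicts_eq_empty (f := f) hempty]
  · refine union_subset hZN (image_subset_iff.2 fun p hp => ?_)
    obtain ⟨w, hw⟩ := hmeet p hp
    rw [landing_of_apply_eq (mem_nearTerminals.1 hp).2 (hempty ▸ notMem_empty p), pair_eq_singleton,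
      mem_inter, mem_singleton] at hw
    exact hw.2 ▸ hw.1

end IsSparse

/-- Any family of pairs indexed by `κ` can be linked in the `n`-cube, avoiding any set of vertices
that leaves enough room. -/
def LinksPairs (n : ℕ) (κ : Type*) [Fintype κ] : Prop :=
  ∀ (T : κ × Bool → Fin n → Bool) (W : Finset (Fin n → Bool)), Function.Injective T →
    (∀ p, T p ∉ W) → 2 * Fintype.card κ + #W ≤ n + 1 → LinkedAvoiding (cube n) T {w | w ∈ W}

theorem IsIsolated.not_isIsolated_of_ne (h : IsIsolated T Z e i₀) (hn : 4 ≤ n) {i₁ : ι}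
    (hi : i₁ ≠ i₀) : ¬ IsIsolated T Z e i₁ := by
  obtain ⟨hall, c, hN⟩ := h
  rintro ⟨-, c', hN'⟩
  have hside : ∀ c, T (i₁, c) e = T (i₀, false) e := fun c => hall (i₁, c) hi
  have hfoot : foot T e i₁ c' = T (i₁, c') :=
    update_eq_self_of_apply ((hside c').trans (hside false).symm)
  rw [hfoot, hside] at hN'
  have hadj : T (i₁, c') ∈ nbrs e (foot T e i₀ c) := by
    rw [hN]
    exact mem_union_right _ (mem_image_of_mem _ (mem_nearTerminals.2 ⟨hi, hside c'⟩))
  obtain ⟨w, hw, hw₁⟩ : ∃ w ∈ nbrs e (foot T e i₀ c),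
      w ∉ ({T (i₁, false), T (i₁, true)} : Finset (Fin n → Bool)) := by
    by_contra! hsub
    have := card_le_card hsub
    have := card_le_two (a := T (i₁, false)) (b := T (i₁, true))
    have := card_nbrs_add_one e (foot T e i₀ c)
    omega
  refine Finset.disjoint_left.1 (disjoint_nbrs hadj) hw ?_
  rw [hN', mem_union]
  refine (mem_union.1 (hN ▸ hw)).imp_right fun hwT => ?_
  obtain ⟨⟨j, c''⟩, hj, rfl⟩ := mem_image.1 hwT
  refine mem_image_of_mem _ (mem_nearTerminals.2 ⟨?_, ?_⟩)
  · rintro rfl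
    cases c'' <;> simp at hw₁
  · rw [(mem_nearTerminals.1 hj).2, hside]

section Step

variable {m : ℕ} {e : Fin (m + 1)} {T f : ι × Bool → Fin (m + 1) → Bool}
  {Z : Finset (Fin (m + 1) → Bool)}

namespace IsSparse

theorem disjoint_route_corridor (h : IsSparse T Z) (hf : IsMove T Z e i₀ f) (hp : p.1 ≠ i₀) :
    Disjoint (route T Z e i₀ f p) ({w | w ∈ Z} ∪ corridor T Z e i₀ f) := by
  have hne : ∀ w ∈ route T Z e i₀ f p, w ∈ points T Z → w = T p := fun w =>
    hf.eq_of_mem_route_of_mem_points hp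
  refine Set.disjoint_left.2 fun w hw hw' => ?_
  rcases hw' with hwZ | rfl | ⟨hwe, hwocc⟩
  · exact h.notMem p (hne w hw (mem_points.2 (.inr hwZ)) ▸ hwZ)
  · exact hp (congrArg Prod.fst (h.injective (hne _ hw (apply_mem_points _)))).symm
  · rcases hw with rfl | ⟨hpe, hw⟩
    · exact hf.flipAt_landing_apply_ne p hwe
    · exact hwocc (mem_occupied.2 (.inr ⟨p, ⟨hp, hpe⟩, hw⟩))

theorem disjoint_corridor (h : IsSparse T Z) :
    Disjoint (corridor T Z e i₀ f) {w | w ∈ Z} := by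
  refine Set.disjoint_left.2 fun w hw hwZ => ?_
  rcases hw with rfl | ⟨hwe, hwocc⟩
  · exact h.notMem _ hwZ
  · exact hwocc (mem_occupied.2 (.inl ⟨hwZ, hwe⟩))

theorem reachableWithin_corridor (h : IsSparse T Z) (hf : IsMove T Z e i₀ f)
    (hcross : CanCross T Z e i₀) (hiso : ¬ IsIsolated T Z e i₀) :
    ReachableWithin (cube (m + 1)) (corridor T Z e i₀ f) (T (i₀, false)) (T (i₀, true)) := by
  have hcard : #(occupied T Z e i₀ f) + 3 ≤ 2 * m := by
    have := h.card_occupied_add_five_le (f := f) hcross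
    omega
  have hfree : ∀ c, ¬ nbrs e (foot T e i₀ c) ⊆ occupied T Z e i₀ f := fun c hc =>
    hiso (h.isIsolated_of_nbrs_subset hf hcross hc)
  have hpath := (reachableWithin_facet_of_not_subset hcard (foot_apply_same T e i₀ false)
    (foot_apply_same T e i₀ true) (h.foot_notMem_occupied hf hcross _)
    (h.foot_notMem_occupied hf hcross _) (hfree _) (hfree _)).mono
    (U' := corridor T Z e i₀ f) (Set.subset_insert _ _)
  refine .trans (foot_false T e i₀ ▸ hpath) ?_
  by_cases hne : T (i₀, true) e = T (i₀, false) e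
  · rw [foot, update_eq_self_of_apply hne]
    exact .refl (Set.mem_insert _ _)
  · refine (ReachableWithin.of_adj ?_ (Set.mem_insert _ _) hpath.right_mem).symm
    rw [foot, update_eq_flipAt_of_ne hne]
    exact cube_adj_flipAt _ _

theorem linkedAvoiding_flipAt_landing (h : IsSparse T Z) (hf : IsMove T Z e i₀ f)
    (ih : LinksPairs m {i // i ≠ i₀}) :
    LinkedAvoiding (cube (m + 1))
      (fun p : {i // i ≠ i₀} × Bool => flipAt e (landing T Z e i₀ f (p.1, p.2)))
      {w | w e = !T (i₀, false) e → w ∈ insert (T (i₀, true)) Z} := by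
  have hside : ∀ p, flipAt e (landing T Z e i₀ f p) e = !T (i₀, false) e := fun p => by
    rw [flipAt_same, hf.landing_apply_same]
  refine linkedAvoiding_facet (fun p => hside _) (ih _ _ (fun p q hpq => ?_) (fun p => ?_) ?_)
  · have hflip := congrArg (facetHom e (!T (i₀, false) e)) hpq
    rw [facetHom_removeNth (hside _), facetHom_removeNth (hside _)] at hflip
    have := hf.landing_injOn h.injective p.1.2 q.1.2 (flipAt_injective e hflip)
    rw [Prod.mk.injEq] at this
    exact Prod.ext (Subtype.ext this.1) this.2
  · rw [removeNth_mem_facetTrace (hside _), mem_insert]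
    have hne : ∀ w ∈ points T Z, flipAt e (landing T Z e i₀ f (p.1, p.2)) = w →
        w = T (p.1, p.2) := by
      rintro w hw rfl
      exact hf.flipAt_landing_eq_of_mem_points p.1.2 hw
    rintro (ht | hZ)
    · exact p.1.2 (congrArg Prod.fst (h.injective (hne _ (apply_mem_points _) ht))).symm
    · exact h.notMem _ (hne _ (mem_points.2 (.inr hZ)) rfl ▸ hZ)
  · have hZ := h.card_filter_le e (!T (i₀, false) e)
    have htrace := card_facetTrace_le e (!T (i₀, false) e) (insert (T (i₀, true)) Z)
    have hinsert : #((insert (T (i₀, true)) Z).filter (· e = !T (i₀, false) e)) ≤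
        #(Z.filter (· e = !T (i₀, false) e)) + 1 := by
      rw [filter_insert]
      split_ifs
      exacts [card_insert_le _ _, Nat.le_succ _]
    have hcard : Fintype.card {i // i ≠ i₀} = Fintype.card ι - 1 := by simp
    have : 0 < Fintype.card ι := Fintype.card_pos_iff.2 ⟨i₀⟩
    omega

/-- The pair `i₀` is joined on its side of the direction `e` and all other pairs are joined on the
opposite side. -/
theorem linkedAvoiding_of_canCross (h : IsSparse T Z) (ih : LinksPairs m {i // i ≠ i₀})
    (hcross : CanCross T Z e i₀) (hblocked : ¬ IsBlocked T Z e i₀)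
    (hiso : ¬ IsIsolated T Z e i₀) : LinkedAvoiding (cube (m + 1)) T {w | w ∈ Z} := by
  obtain ⟨f, hf⟩ := h.exists_isMove hblocked
  refine .insertPair ?_ h.disjoint_corridor (h.reachableWithin_corridor hf hcross hiso)
  refine (h.linkedAvoiding_flipAt_landing hf ih).extend
    (A := fun p => route T Z e i₀ f (p.1, p.2))
    (fun p q hpq => hf.disjoint_route h.injective p.1.2 q.1.2 fun heq => hpq ?_)
    (fun p => hf.reachableWithin_route _) (fun p w hw => ?_)
    (fun p => h.disjoint_route_corridor hf p.1.2) ?_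
  · rw [Prod.mk.injEq] at heq
    exact Prod.ext (Subtype.ext heq.1) heq.2
  · exact (hf.apply_eq_of_mem_route hw).imp_right fun hwe hwe' =>
      absurd (hwe.symm.trans hwe') (Bool.not_ne_self _).symm
  · rintro w (hwZ | rfl | ⟨hwe, -⟩) hwe'
    exacts [mem_insert_of_mem hwZ, mem_insert_self _ _,
      absurd (hwe.symm.trans hwe') (Bool.not_ne_self _).symm]

theorem linkedAvoiding_of_isBlocked (h : IsSparse T Z) (ih : ∀ i, LinksPairs m {j : ι // j ≠ i})
    (hblocked : IsBlocked T Z e i₀) : LinkedAvoiding (cube (m + 1)) T {w | w ∈ Z} := by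
  obtain ⟨p, hp, hN⟩ := hblocked
  obtain ⟨hp₀, hpe, hflip⟩ := mem_conflicts.1 (hp ▸ mem_singleton_self p)
  have hne : ∀ c, (p.1, c) ≠ (i₀, false) := fun c hpc => hp₀ (congrArg Prod.fst hpc)
  obtain ⟨g, hg, hside⟩ := h.exists_flipAt_eq_of_nbrs_subset hflip hN hpe.symm (hne p.2).symm
  have hpair : ∀ c, T (p.1, c) g = T p g := fun c =>
    hside _ (h.apply_mem_cluster hflip hN _) (h.injective.ne (hne c))
  refine h.linkedAvoiding_of_canCross (e := g) (ih p.1)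
    (fun hne' => absurd ((hpair true).trans (hpair false).symm) hne') ?_ ?_
  · rintro ⟨q, hq, -⟩
    obtain ⟨hq₀, hqg, hqflip⟩ := mem_conflicts.1 (hq ▸ mem_singleton_self q)
    rcases h.mem_cluster_or_le_hammingDist hflip hN hqflip with hmem | ⟨-, hfar⟩
    · have hside' := hside _ hmem fun hs =>
        hq₀ (congrArg Prod.fst (h.injective (flipAt_injective g (hs.trans hg.symm))))
      rw [flipAt_same, hqg, hpair] at hside'
      exact Bool.not_ne_self _ hside'
    · have := hammingDist_le_two_of_mem_cluster (h.apply_mem_cluster hflip hN q)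
      have := hammingDist_flipAt_le g (T q)
      have := hammingDist_triangle (T p) (T q) (flipAt g (T q))
      omega
  · rintro ⟨hall, -⟩
    have hs := hall (i₀, false) (Ne.symm hp₀)
    rw [hpair, ← hg, flipAt_same] at hs
    exact Bool.not_ne_self _ hs

theorem linkedAvoiding_of_not_isIsolated (h : IsSparse T Z)
    (ih : ∀ i, LinksPairs m {j : ι // j ≠ i}) (hcross : CanCross T Z e i₀)
    (hiso : ¬ IsIsolated T Z e i₀) : LinkedAvoiding (cube (m + 1)) T {w | w ∈ Z} := by
  by_cases hblocked : IsBlocked T Z e i₀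
  · exact h.linkedAvoiding_of_isBlocked ih hblocked
  · exact h.linkedAvoiding_of_canCross (ih i₀) hcross hblocked hiso

theorem linkedAvoiding (h : IsSparse T Z) (hι : 2 ≤ Fintype.card ι)
    (ih : ∀ i, LinksPairs m {j : ι // j ≠ i}) :
    LinkedAvoiding (cube (m + 1)) T {w | w ∈ Z} := by
  have := Fintype.one_lt_card_iff_nontrivial.1 hι
  by_cases hside : ∃ i e, T (i, true) e = T (i, false) e
  · obtain ⟨i, e, hie⟩ := hside
    obtain ⟨j, hj⟩ := exists_ne i
    by_cases hiso : IsIsolated T Z e i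
    · exact h.linkedAvoiding_of_not_isIsolated ih (i₀ := j)
        (fun hne => absurd ((hiso.1 (j, true) hj).trans (hiso.1 (j, false) hj).symm) hne)
        (hiso.not_isIsolated_of_ne h.four_le hj)
    · exact h.linkedAvoiding_of_not_isIsolated ih (fun hne => absurd hie hne) hiso
  · push Not at hside
    obtain ⟨i, j, hij⟩ := exists_pair_ne ι
    obtain ⟨e, he⟩ := h.exists_flipAt_notMem (hside i)
    exact h.linkedAvoiding_of_not_isIsolated ih (fun _ => he) fun hiso =>
      hside j e ((hiso.1 (j, true) hij.symm).trans (hiso.1 (j, false) hij.symm).symm)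

end IsSparse

end Step

end Linking

end Sparse

theorem linksPairs {n : ℕ} {κ : Type*} [Fintype κ] (hn : 2 ≤ Fintype.card κ → 4 ≤ n) :
    LinksPairs n κ := by
  classical
  intro T W hT hTW hcard
  induction hk : Fintype.card κ generalizing n κ with
  | zero =>
    have := Fintype.card_eq_zero_iff.1 hk
    exact ⟨fun _ => ∅, fun i => isEmptyElim i, fun i => isEmptyElim i⟩
  | succ k ih =>
    by_cases hκ : 2 ≤ Fintype.card κ
    · obtain ⟨m, rfl⟩ : ∃ m, n = m + 1 := ⟨n - 1, by have := hn hκ; omega⟩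
      refine IsSparse.linkedAvoiding ⟨hT, hTW, hn hκ, .inl hcard⟩ hκ fun i T' W' hT' hTW' hcard' =>
        have hi : Fintype.card {j // j ≠ i} = k := by simp [hk]
        ih (by omega) T' W' hT' hTW' hcard' hi
    · have := Fintype.card_le_one_iff_subsingleton.1 (Nat.le_of_lt_succ (not_le.1 hκ))
      exact ⟨fun _ => {w | w ∉ W}, fun i j hij => (hij (Subsingleton.elim i j)).elim, fun i =>
        ⟨disjoint_compl_left, reachableWithin_of_card_le W (by omega) (hTW _) (hTW _)⟩⟩

theorem linkedAvoiding_opposite {d : ℕ} (hd₁ : d ≠ 1) (hd₃ : d ≠ 3) (v : Fin (d + 1) → Bool)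
    {T : Fin ((d + 1) / 2) × Bool → Fin (d + 1) → Bool} (hT : Function.Injective T)
    (hTv : ∀ p, T p ∉ ({v, opposite v} : Finset (Fin (d + 1) → Bool))) :
    LinkedAvoiding (cube (d + 1)) T {v, opposite v} := by
  suffices h : LinkedAvoiding (cube (d + 1)) T
      {w | w ∈ ({v, opposite v} : Finset (Fin (d + 1) → Bool))} from
    h.mono (by simp [Set.subset_def])
  have hpair : #({v, opposite v} : Finset (Fin (d + 1) → Bool)) ≤ 2 := card_le_two
  by_cases hd : Even d
  · have := Nat.two_mul_div_two_of_even hd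
    refine linksPairs (fun hk => ?_) T _ hT hTv ?_ <;> rw [Fintype.card_fin] at * <;> omega
  · have := Nat.not_even_iff.1 hd
    refine IsSparse.linkedAvoiding ⟨hT, hTv, by omega, .inr ⟨?_, by omega, v, rfl⟩⟩ ?_ fun i =>
      linksPairs fun _ => by omega
    all_goals rw [Fintype.card_fin]; omega

section Complex

variable {n : ℕ} {X : Set (Fin n → Bool)} {x y : Fin n → Bool}

theorem singleton_mem_faces (x : Fin n → Bool) : {x} ∈ faces n :=
  .inr ⟨Set.univ, x, by ext y; simp [funext_iff]⟩

theorem pair_mem_faces (h : (cube n).Adj x y) : {x, y} ∈ faces n := by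
  obtain ⟨e, rfl⟩ := h
  refine .inr ⟨{e}ᶜ, x, ?_⟩
  ext y
  refine ⟨?_, fun hy => ?_⟩
  · rintro (rfl | rfl) i hi
    exacts [rfl, flipAt_of_ne hi x]
  · have hupdate : Function.update x e (y e) = y :=
      Function.update_eq_iff.2 ⟨rfl, fun i hi => (hy i hi).symm⟩
    by_cases hye : x e = y e
    · exact .inl (hupdate.symm.trans (update_eq_self_of_apply hye))
    · exact .inr (hupdate.symm.trans (update_eq_flipAt_of_ne hye))

theorem singleton_mem_deleteVerts : {x} ∈ FaceComplex.deleteVerts (faces n) X ↔ x ∉ X := by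
  simp [FaceComplex.deleteVerts, singleton_mem_faces]

theorem comap_val_le_graph_deleteVerts (X : Set (Fin n → Bool)) :
    (cube n).comap Subtype.val ≤ FaceComplex.graph (FaceComplex.deleteVerts (faces n) X) :=
  fun x y hxy => ⟨hxy.ne, pair_mem_faces hxy,
    Set.pair_subset (singleton_mem_deleteVerts.1 x.2) (singleton_mem_deleteVerts.1 y.2)⟩

theorem card_vertices_deleteVerts (X : Finset (Fin n → Bool)) :
    ENat.card {x // {x} ∈ FaceComplex.deleteVerts (faces n) X} = ((2 ^ n - #X : ℕ) : ℕ∞) := by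
  simp only [singleton_mem_deleteVerts, mem_coe]
  rw [ENat.card_eq_coe_fintype_card, Fintype.card_subtype_compl]
  simp

theorem opposite_ne_self (hn : 0 < n) (v : Fin n → Bool) : opposite v ≠ v := fun h =>
  Bool.not_ne_self _ (congrFun h ⟨0, hn⟩)

theorem opposite_notMem_of_mem_link {v : Fin n → Bool} {F : Set (Fin n → Bool)}
    (hF : F ∈ FaceComplex.link (boundary n) v) : opposite v ∉ F := by
  obtain ⟨⟨-, G, ⟨hG, hGne⟩, hvG, hFG⟩, -⟩ := hF
  intro hoppF
  rcases hG with rfl | ⟨I, a, rfl⟩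
  · exact hvG
  · refine hGne (Set.eq_univ_of_forall fun x i hi => ?_)
    exact absurd ((hFG hoppF i hi).trans (hvG i hi).symm) (Bool.not_ne_self _)

theorem exists_mem_boundary_of_opposite_notMem (hn : 0 < n) {v : Fin n → Bool}
    {F : Set (Fin n → Bool)} (hF : F ∈ faces n) (hv : opposite v ∉ F) :
    ∃ G ∈ boundary n, v ∈ G ∧ F ⊆ G := by
  rcases hF with rfl | ⟨I, a, rfl⟩
  · exact ⟨{v}, ⟨singleton_mem_faces v, fun h => opposite_ne_self hn v
      (Set.mem_singleton_iff.1 (h ▸ Set.mem_univ (opposite v)))⟩, rfl, Set.empty_subset _⟩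
  · simp only [Set.mem_ofPred_eq, not_forall] at hv
    obtain ⟨j, hj, hja⟩ := hv
    have hvj : v j = a j := by
      simpa only [opposite_opposite] using opposite_apply_eq_of_ne hja
    refine ⟨{x | x j = a j}, ⟨.inr ⟨{j}, a, by simp⟩, fun h => hja ?_⟩, hvj, fun x hx => hx j hj⟩
    exact (h ▸ Set.mem_univ (opposite v) : opposite v ∈ {x | x j = a j})

theorem link_boundary (hn : 0 < n) (v : Fin n → Bool) :
    FaceComplex.link (boundary n) v = FaceComplex.deleteVerts (faces n) {v, opposite v} := by
  ext F
  constructor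
  · intro hF
    refine ⟨hF.1.1.1, ?_⟩
    rintro x hx (rfl | rfl)
    exacts [hF.2 hx, opposite_notMem_of_mem_link hF hx]
  · rintro ⟨hF, hFv⟩
    have hv : v ∉ F := fun h => hFv h (.inl rfl)
    exact ⟨⟨⟨hF, fun h => hv (h ▸ Set.mem_univ v)⟩,
      exists_mem_boundary_of_opposite_notMem hn hF fun h => hFv h (.inr rfl)⟩, hv⟩

theorem two_mul_half_le_card_vertices {d : ℕ} (v : Fin (d + 1) → Bool) :
    ((2 * ((d + 1) / 2) : ℕ) : ℕ∞) ≤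
      ENat.card {x // {x} ∈ FaceComplex.deleteVerts (faces (d + 1)) {v, opposite v}} := by
  have hcard := card_vertices_deleteVerts ({v, opposite v} : Finset (Fin (d + 1) → Bool))
  rw [coe_pair] at hcard
  rw [hcard, Nat.cast_le, pow_succ]
  have : #({v, opposite v} : Finset (Fin (d + 1) → Bool)) ≤ 2 := card_le_two
  have := Nat.lt_two_pow_self (n := d)
  omega

end Complex

end BoolCube

theorem mainTheorem6 (d : ℕ) (hd1 : d ≠ 1) (hd3 : d ≠ 3) (v : Fin (d + 1) → Bool) :
    FaceComplex.link (BoolCube.boundary (d + 1)) v =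
        FaceComplex.deleteVerts (BoolCube.faces (d + 1)) {v, BoolCube.opposite v} ∧
      (FaceComplex.graph (FaceComplex.link (BoolCube.boundary (d + 1)) v)).IsKLinked
        ((d + 1) / 2) := by
  have hlink := BoolCube.link_boundary d.succ_pos v
  refine ⟨hlink, ?_⟩
  rw [hlink]
  refine isKLinked_of_linkedAvoiding (BoolCube.two_mul_half_le_card_vertices v) fun T hT => ?_
  have hTv : ∀ p, (T p).1 ∉ ({v, BoolCube.opposite v} : Set (Fin (d + 1) → Bool)) := fun p =>
    BoolCube.singleton_mem_deleteVerts.1 (T p).2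
  have hcube := BoolCube.linkedAvoiding_opposite hd1 hd3 v (Subtype.val_injective.comp hT)
    (fun p => by simpa using hTv p)
  refine LinkedAvoiding.of_val (hcube.mono fun x hx => ?_)
    (BoolCube.comap_val_le_graph_deleteVerts _)
  exact not_not.1 (mt BoolCube.singleton_mem_deleteVerts.2 hx)
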